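/- **Setting.** Let $Y$ be a locally finite tree which is uniform, i.e. $\operatorname{Aut}(Y)\backslash Y$ is a finite graph. Let $\Gamma$ be a tree lattice on $Y$: a group acting on $Y$ such that every edge stabilizer $\Gamma_e$ is finite and $\sum_{e \bmod \Gamma} 1/|\Gamma_e|<\infty$. Assume that $\Gamma$ acts without inversions (no element maps an oriented edge $e$ to its reverse $e^{-1}$), and let $X=\Gamma\backslash Y$ be the quotient graph, whose vertices and oriented edges are the $\Gamma$-orbits of vertices and oriented edges of $Y$. Write $o(e)$, $t(e)$ for the origin and terminus of an oriented edge $e$. **Cusps.** A ray in $Y$ is an infinite path without backtracking; two rays are equivalent if, up to a shift, they eventually agree, and an equivalence class $c$ of rays is an end. Vertices $x,y$ lie in the same horocycle of $c$ if there are rays $(r_n)_{n\ge 0},(s_n)_{n\ge 0}$ in $c$ (as vertex sequences) with $r_0=x$, $s_0=y$ and $r_n=s_n$ for some $n\ge 0$. Let $P_c$ be the stabilizer of $c$ in $\operatorname{Aut}(Y)$, and let $N_c\subset P_c$ be the subgroup of the elements stabilizing a (hence every) horocycle of $c$. The end $c$ is a cusp of $\Gamma$ if every element of $\Gamma$ acting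 through $P_c$ acts through $N_c$, and the group of these elements acts transitively on some horocycle of $c$. The cusp is periodic if the sequence of valencies of the vertices along a ray in $c$ is eventually periodic. The lattice $\Gamma$ is cuspidal if $X$ is the union of a finite graph and the images of finitely many rays representing periodic cusps. **Weights and cycles.** For an oriented edge $e$ of $X$ put $w(e)=|\Gamma_{o(\tilde e)}\tilde e|$, where $\tilde e$ is any preimage of $e$ in $Y$. If $t(e)=o(e')$, put $w(e,e')=w(e')$ for $e'\neq e^{-1}$ and $w(e,e^{-1})=w(e^{-1})-1$. A cycle $c$ in $X$ is a nonempty closed path $(e_1,\dots,e_n)$ up to cyclic shifts; its length is $l(c)=n$ and its weight is $w(c)=\prod_{j \bmod n}w(e_j,e_{j+1})$. A cycle is prime if it is not a power of a shorter cycle. **Theorem 2.2.** Suppose that $\Gamma$ is cuspidal. Then the Euler product $$Z(u)=\prod_c\bigl(1-w(c)u^{l(c)}\bigr)^{-1},$$ over all prime cycles $c$ of $X$, converges for small $|u|$ to a rational function of $u$. That is, there are $\varepsilon>0$ and polynomials $p,q\in\mathbb C[u]$ such that for all $u\in\mathbb C$ with $|u|<\varepsilon$ all the factors are defined ($1-w(c)u^{l(c)}\ne0$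 for every $c$), $p(u)\neq 0$, $q(u)\ne0$, and the product converges unconditionally, with value $Z(u)=p(u)/q(u)$. -/

import Mathlib

namespace TreeLattice

/- Trees are simple graphs `Y` with `Y.IsTree`, the oriented edges of `Y` are the elements of
`Y.Dart` (`e.fst` is the origin, `e.snd` the terminus, `e.symm` the reversed edge), and `Y ≃g Y` is
the automorphism group of `Y`. An action of a group `Γ` on `Y` is a homomorphism
`α : Γ →* (Y ≃g Y)`. -/

section Quotient

variable {V : Type*} {Y : SimpleGraph V} {Γ : Type*} [Group Γ]

/-- The action of an automorphism on oriented edges. -/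
def dartMap (g : Y ≃g Y) (e : Y.Dart) : Y.Dart :=
  ⟨(g e.fst, g e.snd), g.map_adj_iff.2 e.adj⟩

theorem dartMap_one (e : Y.Dart) : dartMap (1 : Y ≃g Y) e = e := rfl

theorem dartMap_mul (g h : Y ≃g Y) (e : Y.Dart) :
    dartMap (g * h) e = dartMap g (dartMap h e) := rfl

theorem dartMap_inv_self (g : Y ≃g Y) (e : Y.Dart) : dartMap g⁻¹ (dartMap g e) = e := by
  rw [← dartMap_mul, inv_mul_cancel, dartMap_one]

/-- Two vertices are equivalent if they lie in the same `Γ`-orbit. -/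
def vertexSetoid (α : Γ →* (Y ≃g Y)) : Setoid V where
  r x y := ∃ g : Γ, α g x = y
  iseqv :=
    { refl := fun x => ⟨1, by rw [map_one]; rfl⟩
      symm := by
        rintro x _ ⟨g, rfl⟩
        refine ⟨g⁻¹, ?_⟩
        change (α g⁻¹ * α g) x = x
        rw [← map_mul, inv_mul_cancel, map_one]; rfl
      trans := by
        rintro x _ _ ⟨g, rfl⟩ ⟨h, rfl⟩
        exact ⟨h * g, by rw [map_mul]; rfl⟩ }

/-- Two oriented edges are equivalent if they lie in the same `Γ`-orbit. -/
def edgeSetoid (α : Γ →* (Y ≃g Y)) : Setoid Y.Dart where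
  r e f := ∃ g : Γ, dartMap (α g) e = f
  iseqv :=
    { refl := fun x => ⟨1, by rw [map_one]; rfl⟩
      symm := by
        rintro x _ ⟨g, rfl⟩
        exact ⟨g⁻¹, by rw [map_inv, dartMap_inv_self]⟩
      trans := by
        rintro x _ _ ⟨g, rfl⟩ ⟨h, rfl⟩
        exact ⟨h * g, by rw [map_mul]; rfl⟩ }

/-- The vertices of the quotient graph `X = Γ \ Y`. -/
def QVertex (α : Γ →* (Y ≃g Y)) : Type _ := Quotient (vertexSetoid α)

/-- The oriented edges of the quotient graph `X = Γ \ Y`. -/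
def QEdge (α : Γ →* (Y ≃g Y)) : Type _ := Quotient (edgeSetoid α)

/-- The projection `Y → X` on vertices. -/
def projV (α : Γ →* (Y ≃g Y)) (x : V) : QVertex α := Quotient.mk (vertexSetoid α) x

/-- The projection `Y → X` on oriented edges. -/
def projE (α : Γ →* (Y ≃g Y)) (e : Y.Dart) : QEdge α := Quotient.mk (edgeSetoid α) e

variable {α : Γ →* (Y ≃g Y)}

/-- The origin of an oriented edge of `X`. -/
def QEdge.origin : QEdge α → QVertex α :=
  Quotient.lift (fun e : Y.Dart => projV α e.fst) (by
    rintro e _ ⟨g, rfl⟩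
    exact Quotient.sound ⟨g, rfl⟩)

/-- The terminus of an oriented edge of `X`. -/
def QEdge.terminus : QEdge α → QVertex α :=
  Quotient.lift (fun e : Y.Dart => projV α e.snd) (by
    rintro e _ ⟨g, rfl⟩
    exact Quotient.sound ⟨g, rfl⟩)

/-- The reverse of an oriented edge of `X`. -/
def QEdge.inv : QEdge α → QEdge α :=
  Quotient.lift (fun e : Y.Dart => projE α e.symm) (by
    rintro e _ ⟨g, rfl⟩
    exact Quotient.sound ⟨g, rfl⟩)

end Quotient

section Lattice

variable {V : Type*} {Y : SimpleGraph V} {Γ : Type*} [Group Γ]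

/-- A uniform tree: a locally finite tree whose quotient by its full automorphism group is a finite
graph. -/
structure IsUniformTree (Y : SimpleGraph V) : Prop where
  isTree : Y.IsTree
  locallyFinite : ∀ x : V, (Y.neighborSet x).Finite
  finite_vertices : Finite (QVertex (MonoidHom.id (Y ≃g Y)))
  finite_edges : Finite (QEdge (MonoidHom.id (Y ≃g Y)))

/-- The stabilizer `Γ_e` of an oriented edge. -/
def edgeStab (α : Γ →* (Y ≃g Y)) (e : Y.Dart) : Set Γ := {g | dartMap (α g) e = e}

theorem ncard_edgeStab_dartMap (α : Γ →* (Y ≃g Y)) (g : Γ) (e : Y.Dart) :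
    (edgeStab α (dartMap (α g) e)).ncard = (edgeStab α e).ncard := by
  have h : edgeStab α (dartMap (α g) e) = (MulAut.conj g) '' edgeStab α e := by
    ext k
    constructor
    · intro hk
      refine ⟨g⁻¹ * k * g, ?_, by simp [mul_assoc]⟩
      change dartMap (α (g⁻¹ * k * g)) e = e
      have hk' : dartMap (α k) (dartMap (α g) e) = dartMap (α g) e := hk
      rw [map_mul, map_mul, dartMap_mul, dartMap_mul, hk', map_inv, dartMap_inv_self]
    · rintro ⟨k, hk, rfl⟩
      have hk' : dartMap (α k) e = e := hk
      change dartMap (α (g * k * g⁻¹)) (dartMap (α g) e) = _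
      rw [map_mul, map_mul, dartMap_mul, dartMap_mul, map_inv, dartMap_inv_self, hk']
  rw [h, Set.ncard_image_of_injective _ (MulAut.conj g).injective]

/-- The number `|Γ_e|`, as a function of the class of `e` modulo `Γ`. -/
noncomputable def QEdge.stabCard {α : Γ →* (Y ≃g Y)} : QEdge α → ℕ :=
  Quotient.lift (fun e : Y.Dart => (edgeStab α e).ncard) (by
    rintro e _ ⟨g, rfl⟩
    exact (ncard_edgeStab_dartMap α g e).symm)

/-- A tree lattice: all edge stabilizers are finite and the sum of `1 / |Γ_e|` over the edges
modulo `Γ` is finite. -/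
structure IsTreeLattice (α : Γ →* (Y ≃g Y)) : Prop where
  finite_stab : ∀ e : Y.Dart, (edgeStab α e).Finite
  summable : Summable fun e : QEdge α => (1 : ℝ) / (e.stabCard : ℝ)

/-- `Γ` acts without inversions: no element maps an oriented edge to its reverse. -/
def WithoutInversions (α : Γ →* (Y ≃g Y)) : Prop :=
  ∀ (g : Γ) (e : Y.Dart), dartMap (α g) e ≠ e.symm

end Lattice

section Ends

variable {V : Type*} {Y : SimpleGraph V}

/-- A ray in `Y`: an infinite reduced path, given by its sequence of vertices. -/
@[ext]
structure Ray (Y : SimpleGraph V) where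
  vertex : ℕ → V
  adj : ∀ n, Y.Adj (vertex n) (vertex (n + 1))
  reduced : ∀ n, vertex (n + 2) ≠ vertex n

/-- The `n`-th oriented edge of a ray. -/
def Ray.edge (r : Ray Y) (n : ℕ) : Y.Dart := ⟨(r.vertex n, r.vertex (n + 1)), r.adj n⟩

/-- The image of a ray under an automorphism. -/
def Ray.map (g : Y ≃g Y) (r : Ray Y) : Ray Y where
  vertex n := g (r.vertex n)
  adj n := g.map_adj_iff.2 (r.adj n)
  reduced n h := r.reduced n (g.injective h)

/-- Two rays are equivalent if they agree from some point on, up to a shift. -/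
def raySetoid (Y : SimpleGraph V) : Setoid (Ray Y) where
  r r s := ∃ a b : ℕ, ∀ n, r.vertex (n + a) = s.vertex (n + b)
  iseqv :=
    { refl := fun _ => ⟨0, 0, fun _ => rfl⟩
      symm := fun ⟨a, b, h⟩ => ⟨b, a, fun n => (h n).symm⟩
      trans := by
        rintro r s t ⟨a, b, h⟩ ⟨c, d, k⟩
        refine ⟨c + a, b + d, fun n => ?_⟩
        have h1 := h (n + c)
        have h2 := k (n + b)
        rw [show n + (c + a) = n + c + a by omega, h1,
          show n + c + b = n + b + c by omega, h2,
          show n + b + d = n + (b + d) by omega] }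

/-- The boundary `∂Y`: the set of ends of `Y`. -/
def Boundary (Y : SimpleGraph V) : Type _ := Quotient (raySetoid Y)

/-- The end of a ray. -/
def Ray.toEnd (r : Ray Y) : Boundary Y := Quotient.mk (raySetoid Y) r

/-- The action of an automorphism on the boundary. -/
def Boundary.map (g : Y ≃g Y) : Boundary Y → Boundary Y :=
  Quotient.lift (fun r : Ray Y => (r.map g).toEnd) (by
    rintro r s ⟨a, b, h⟩
    exact Quotient.sound ⟨a, b, fun n => congrArg g (h n)⟩)

/-- Two vertices lie in the same horocycle with respect to the end `c`. -/
def SameHorocycle (c : Boundary Y) (x y : V) : Prop :=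
  ∃ r s : Ray Y, r.toEnd = c ∧ s.toEnd = c ∧ r.vertex 0 = x ∧ s.vertex 0 = y ∧
    ∃ n, r.vertex n = s.vertex n

/-- The horocycles with respect to the end `c`. -/
def IsHorocycle (c : Boundary Y) (H : Set V) : Prop :=
  ∃ x : V, H = {y | SameHorocycle c x y}

/-- The stabilizer `P_c` of the end `c` in the automorphism group. -/
def endStab (c : Boundary Y) : Set (Y ≃g Y) := {g | Boundary.map g c = c}

/-- The set `N_c` of all elements of `P_c` that stabilize a horocycle with respect to `c`. -/
def horoStab (c : Boundary Y) : Set (Y ≃g Y) :=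
  {g | g ∈ endStab c ∧ ∃ H : Set V, IsHorocycle c H ∧ g '' H = H}

/-- The valency of a vertex. -/
noncomputable def valency (Y : SimpleGraph V) (x : V) : ℕ := (Y.neighborSet x).ncard

/-- The sequence of valencies along the ray is eventually periodic. -/
def Ray.IsPeriodic (r : Ray Y) : Prop :=
  ∃ N k : ℕ, 0 < k ∧ ∀ n, N ≤ n → valency Y (r.vertex n) = valency Y (r.vertex (n + k))

variable {Γ : Type*} [Group Γ]

/-- The end `c` is a cusp of `Γ`: `Γ ∩ P_c = Γ ∩ N_c`, and this group acts transitively on some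
horocycle. -/
def IsCusp (α : Γ →* (Y ≃g Y)) (c : Boundary Y) : Prop :=
  (∀ g : Γ, α g ∈ endStab c ↔ α g ∈ horoStab c) ∧
  ∃ H : Set V, IsHorocycle c H ∧
    ∀ x ∈ H, ∀ y ∈ H, ∃ g : Γ, α g ∈ horoStab c ∧ α g x = y

/-- `Γ` is cuspidal: the quotient graph `X` is the union of a finite subgraph, with vertices `VF`
and oriented edges `EF`, and of the images of finitely many rays which represent periodic cusps. -/
def IsCuspidal (α : Γ →* (Y ≃g Y)) : Prop :=
  ∃ (VF : Set (QVertex α)) (EF : Set (QEdge α)) (R : Set (Ray Y)),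
    VF.Finite ∧ EF.Finite ∧ R.Finite ∧
    (∀ e ∈ EF, e.inv ∈ EF ∧ e.origin ∈ VF ∧ e.terminus ∈ VF) ∧
    (∀ r ∈ R, IsCusp α r.toEnd ∧ r.IsPeriodic) ∧
    (∀ x : QVertex α, x ∈ VF ∨ ∃ r ∈ R, ∃ n, x = projV α (r.vertex n)) ∧
    (∀ e : QEdge α, e ∈ EF ∨ ∃ r ∈ R, ∃ n,
      e = projE α (r.edge n) ∨ e = projE α (r.edge n).symm)

end Ends

section Zeta

variable {V : Type*} {Y : SimpleGraph V} {Γ : Type*} [Group Γ]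

/-- The orbit `Γ_{o(e)} e` of an oriented edge under the stabilizer of its origin. -/
def originOrbit (α : Γ →* (Y ≃g Y)) (e : Y.Dart) : Set Y.Dart :=
  {f | ∃ g : Γ, α g e.fst = e.fst ∧ dartMap (α g) e = f}

theorem ncard_originOrbit_dartMap (α : Γ →* (Y ≃g Y)) (g : Γ) (e : Y.Dart) :
    (originOrbit α (dartMap (α g) e)).ncard = (originOrbit α e).ncard := by
  have inj : Function.Injective (dartMap (α g)) :=
    Function.LeftInverse.injective (dartMap_inv_self (α g))
  have h : originOrbit α (dartMap (α g) e) = dartMap (α g) '' originOrbit α e := by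
    ext f
    constructor
    · rintro ⟨k, hk, rfl⟩
      refine ⟨dartMap (α (g⁻¹ * k * g)) e, ⟨g⁻¹ * k * g, ?_, rfl⟩, ?_⟩
      · have hk' : α k (α g e.fst) = α g e.fst := hk
        rw [map_mul, map_mul]
        change α g⁻¹ (α k (α g e.fst)) = e.fst
        rw [hk']
        change (α g⁻¹ * α g) e.fst = e.fst
        rw [← map_mul, inv_mul_cancel, map_one]; rfl
      · rw [← dartMap_mul, ← map_mul, ← dartMap_mul, ← map_mul]
        congr 2
        group
    · rintro ⟨_, ⟨k, hk, rfl⟩, rfl⟩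
      refine ⟨g * k * g⁻¹, ?_, ?_⟩
      · change α (g * k * g⁻¹) (α g e.fst) = α g e.fst
        change (α (g * k * g⁻¹) * α g) e.fst = α g e.fst
        rw [← map_mul, inv_mul_cancel_right, map_mul]
        change α g (α k e.fst) = α g e.fst
        rw [hk]
      · rw [← dartMap_mul, ← map_mul, ← dartMap_mul, ← map_mul, inv_mul_cancel_right]
  rw [h, Set.ncard_image_of_injective _ inj]

/-- The weight `w(e) = |Γ_{o(e')} e'|` of an oriented edge `e` of `X`, where `e'` is any preimage
of `e` in `Y`. -/
noncomputable def QEdge.weight {α : Γ →* (Y ≃g Y)} : QEdge α → ℕ :=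
  Quotient.lift (fun e : Y.Dart => (originOrbit α e).ncard) (by
    rintro e _ ⟨g, rfl⟩
    exact (ncard_originOrbit_dartMap α g e).symm)

open Classical in
/-- The weight `w(e, e')` of a pair of consecutive edges of `X`. -/
noncomputable def pairWeight {α : Γ →* (Y ≃g Y)} (e e' : QEdge α) : ℤ :=
  if e' = e.inv then (e'.weight : ℤ) - 1 else (e'.weight : ℤ)

/-- The weight of a closed path: the product of `w(e_j, e_{j+1})` over all `j`, cyclically. -/
noncomputable def pathWeight {α : Γ →* (Y ≃g Y)} (p : List (QEdge α)) : ℤ :=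
  (List.zipWith pairWeight p (p.rotate 1)).prod

theorem pathWeight_eq_of_isRotated {α : Γ →* (Y ≃g Y)} {p q : List (QEdge α)}
    (h : p ~r q) : pathWeight p = pathWeight q := by
  obtain ⟨n, rfl⟩ := h
  unfold pathWeight
  rw [List.rotate_rotate, Nat.add_comm, ← List.rotate_rotate,
    ← List.zipWith_rotate_distrib _ _ _ _ (by simp)]
  exact ((List.rotate_perm _ n).prod_eq).symm

/-- The weight of a cyclic sequence of edges (that is, of a list up to cyclic shifts). -/
noncomputable def cycleWeight {α : Γ →* (Y ≃g Y)} : Cycle (QEdge α) → ℤ :=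
  Quotient.lift pathWeight fun _ _ h => pathWeight_eq_of_isRotated h

/-- A cycle in `X`: an equivalence class of nonempty closed paths modulo cyclic shifts. -/
def IsGraphCycle {α : Γ →* (Y ≃g Y)} (c : Cycle (QEdge α)) : Prop :=
  c ≠ Cycle.nil ∧ c.Chain fun e e' => e.terminus = e'.origin

/-- A prime cycle: one that is not a power (the `m`-fold repetition of a closed path `p`) of a
shorter cycle. -/
def IsPrimeCycle {α : Γ →* (Y ≃g Y)} (c : Cycle (QEdge α)) : Prop :=
  IsGraphCycle c ∧
  ∀ (p : List (QEdge α)) (m : ℕ), IsGraphCycle (p : Cycle (QEdge α)) → p.length < c.length →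
    c ≠ ((List.replicate m p).flatten : Cycle (QEdge α))

/-- The set of prime cycles of `X = Γ \ Y`. -/
def PrimeCycle (α : Γ →* (Y ≃g Y)) : Type _ := {c : Cycle (QEdge α) // IsPrimeCycle c}

/-- The weight `w(c)` of a prime cycle. -/
noncomputable def PrimeCycle.weight {α : Γ →* (Y ≃g Y)} (c : PrimeCycle α) : ℤ :=
  cycleWeight c.1

/-- The length `l(c)` of a prime cycle. -/
def PrimeCycle.length {α : Γ →* (Y ≃g Y)} (c : PrimeCycle α) : ℕ := c.1.length

end Zeta

end TreeLattice

/-!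
For a finite matrix `T` the identity `det (1 - u T) = exp (-∑ tr (T ^ n) u ^ n / n)` holds for small
`u` (`exp_tsum_trace_mul_det`). Its traces are sums over closed words, and every closed word is a
power of a unique prime cyclic word. Grouping the words by these prime words turns the identity into
an Euler product, `∏ (1 - w(c) u ^ l(c))⁻¹ = 1 / det (1 - u T)`
(`hasSum_neg_log_of_hasSum_wordTerm`). For the infinite graph `X` this is applied to the weights cut
off at height `K` in the cusps; since all weights are nonnegative, dominated convergence allows `K`
to tend to infinity as soon as the determinants converge to a function without zeros
(`hasProd_of_tendsto_det`).

The shape of `X` enters as follows. Far out on a ray in a cusp, the stabilizer of the ray acts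
transitively on the infinite branches leading away from the cusp (`IsCusp.exists_transitive`). If
the image of the ray in `X` is infinite, then far out all branches are infinite
(`exists_forall_extends`): otherwise the stabilizers of the edges of the ray would have bounded
order, which the finiteness of `∑ 1 / |Γ_e|` permits for only finitely many edges of `X`. So at each
vertex of the image there are just two edges of `X`, the next edge of the path and the inverse of
the previous one. The path can then be folded back at most once, and from some point on it is a
half-line without repetitions, with weight `1` on the ascending edges and weight one less than the
valency on the descending ones (`exists_isCuspPath`). If half-lines that merge are counted once
and all of them are shortened, they become disjoint; so `X` consists of a finite core and finitely
many disjoint half-lines with periodic weights (`exists_isCuspFamily`).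

A path that has turned downwards in a cusp cannot turn up again, as the weight of that turn is
`1 - 1 = 0`. Hence the matrix of the transitions inside the truncated cusps is nilpotent, and a block
elimination (`det_cusp_elimination`) reduces the determinant to one of the fixed size of the core,
in which each cusp contributes the generating function of the excursions of height at most `K`. By
periodicity these functions converge to rational functions (`exists_tendsto_excursion`), and so do
the determinants (`exists_rational_limit`).
-/

namespace TreeLattice

/-! ### Traces of powers and the characteristic determinant -/

section TraceDet

open scoped Matrix.Norms.Operator

variable {J : Type*} [Fintype J] [DecidableEq J]

/-- The norm of a matrix is here the maximum of the absolute row sums. -/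
theorem norm_trace_le (M : Matrix J J ℂ) : ‖M.trace‖ ≤ Fintype.card J * ‖M‖ := by
  have hent : ∀ i, ‖M i i‖ ≤ ‖M‖ := fun i => by
    rw [Matrix.linfty_opNorm_def, ← coe_nnnorm, NNReal.coe_le_coe]
    exact (Finset.single_le_sum (f := fun j => ‖M i j‖₊) (fun _ _ => zero_le)
      (Finset.mem_univ i)).trans (Finset.le_sup (f := fun i => ∑ j, ‖M i j‖₊) (Finset.mem_univ i))
  calc ‖M.trace‖ ≤ ∑ i, ‖M i i‖ := norm_sum_le _ _
    _ ≤ ∑ _i : J, ‖M‖ := Finset.sum_le_sum fun i _ => hent i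
    _ = _ := by simp

theorem norm_le_of_rowSum_le {T : Matrix J J ℂ} {B : ℝ} (hB : 0 ≤ B)
    (hT : ∀ i, ∑ j, ‖T i j‖ ≤ B) : ‖T‖ ≤ B := by
  rw [Matrix.linfty_opNorm_def]
  lift B to NNReal using hB
  rw [NNReal.coe_le_coe]
  refine Finset.sup_le fun i _ => ?_
  rw [← NNReal.coe_le_coe]
  simpa using hT i

/-- Jacobi's formula for the pencil `1 - t T`, at a point where it has a right inverse `R`. -/
theorem hasDerivAt_det_one_sub_smul (T R : Matrix J J ℂ) (t₀ : ℂ) (hR : (1 - t₀ • T) * R = 1) :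
    HasDerivAt (fun t : ℂ => (1 - t • T).det) (-((T * R).trace * (1 - t₀ • T).det)) t₀ := by
  obtain ⟨q, hq⟩ : ∃ q : Polynomial ℂ, ∀ h : ℂ,
      (1 + h • (-(R * T))).det = 1 + (-(R * T)).trace * h + q.eval h * h ^ 2 :=
    ⟨_, fun h => Matrix.det_one_add_smul h _⟩
  -- the determinant to first order at `t₀`, after factoring out `1 - t₀ T`
  have hfac : ∀ t : ℂ, (1 - t • T).det
      = (1 - t₀ • T).det * (1 + (-(R * T)).trace * (t - t₀) + q.eval (t - t₀) * (t - t₀) ^ 2) := by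
    intro t
    rw [← hq, ← Matrix.det_mul]
    congr 1
    have : (1 - t₀ • T) * (1 + (t - t₀) • (-(R * T)))
        = (1 - t₀ • T) - (t - t₀) • (((1 - t₀ • T) * R) * T) := by
      simp [mul_add, Matrix.mul_assoc, sub_eq_add_neg]
    rw [this, hR, one_mul, sub_smul]
    abel
  have hd : HasDerivAt (fun t : ℂ => (1 - t₀ • T).det *
      (1 + (-(R * T)).trace * (t - t₀) + q.eval (t - t₀) * (t - t₀) ^ 2))
      (-((T * R).trace * (1 - t₀ • T).det)) t₀ := by
    have h1 : HasDerivAt (fun t : ℂ => t - t₀) 1 t₀ := (hasDerivAt_id t₀).sub_const t₀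
    have h2 : HasDerivAt (fun t : ℂ => q.eval (t - t₀)) (q.derivative.eval (t₀ - t₀) * 1) t₀ :=
      HasDerivAt.comp (h₂ := fun x => q.eval x) t₀ (q.hasDerivAt (t₀ - t₀)) h1
    refine ((((h1.const_mul (-(R * T)).trace).const_add 1).add
      (h2.mul (h1.pow 2))).const_mul (1 - t₀ • T).det).congr_deriv ?_
    simp [Matrix.trace_mul_comm R T]
    ring
  exact hd.congr_of_eventuallyEq (Filter.Eventually.of_forall hfac)

/-- `det (1 - u T) = exp (-∑ tr (T ^ n) u ^ n / n)` near the origin: both sides solve the same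
linear differential equation in `u`. -/
theorem exp_tsum_trace_mul_det {T : Matrix J J ℂ} {B : ℝ} (hB : 0 < B)
    (hT : ∀ i, ∑ j, ‖T i j‖ ≤ B) {u : ℂ} (hu : ‖u‖ * B < 1) :
    Complex.exp (∑' n : ℕ, (T ^ (n + 1)).trace * u ^ (n + 1) / ((n + 1 : ℕ) : ℂ))
      * (1 - u • T).det = 1 := by
  have hTB := norm_le_of_rowSum_le hB.le hT
  -- termwise differentiation takes place on a ball of radius `r` containing `u`
  obtain ⟨r, hur, hrB⟩ : ∃ r, ‖u‖ < r ∧ r * B < 1 := by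
    have : ‖u‖ < 1 / B := by rwa [lt_div_iff₀ hB]
    obtain ⟨r, h1, h2⟩ := exists_between this
    exact ⟨r, h1, by rwa [lt_div_iff₀ hB] at h2⟩
  have hr0 : 0 < r := (norm_nonneg u).trans_lt hur
  have hsm : ∀ t ∈ Metric.ball (0 : ℂ) r, ‖t • T‖ < 1 := by
    intro t ht
    rw [mem_ball_zero_iff] at ht
    calc ‖t • T‖ ≤ ‖t‖ * ‖T‖ := norm_smul_le _ _
      _ ≤ r * B := mul_le_mul ht.le hTB (norm_nonneg _) hr0.le
      _ < 1 := hrB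
  set g : ℕ → ℂ → ℂ := fun n t => (T ^ (n + 1)).trace * t ^ (n + 1) / ((n + 1 : ℕ) : ℂ) with hg
  set g' : ℕ → ℂ → ℂ := fun n t => (T ^ (n + 1)).trace * t ^ n with hg'
  have hder : ∀ n, ∀ t ∈ Metric.ball (0 : ℂ) r, HasDerivAt (g n) (g' n t) t := by
    intro n t _
    have h := (((hasDerivAt_id t).pow (n + 1)).const_mul (T ^ (n + 1)).trace).div_const
      ((n + 1 : ℕ) : ℂ)
    refine h.congr_deriv ?_
    have : ((n : ℂ) + 1) ≠ 0 := by exact_mod_cast n.succ_ne_zero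
    simp only [hg', id, Nat.add_sub_cancel, mul_one]
    push_cast
    field_simp
  have hbound : ∀ n, ∀ t ∈ Metric.ball (0 : ℂ) r,
      ‖g' n t‖ ≤ Fintype.card J * B * (r * B) ^ n := by
    intro n t ht
    rw [mem_ball_zero_iff] at ht
    have h1 : ‖(T ^ (n + 1)).trace‖ ≤ Fintype.card J * B ^ (n + 1) :=
      (norm_trace_le _).trans (mul_le_mul_of_nonneg_left
        ((norm_pow_le' T n.succ_pos).trans (pow_le_pow_left₀ (norm_nonneg _) hTB _))
        (Nat.cast_nonneg _))
    calc ‖g' n t‖ = ‖(T ^ (n + 1)).trace‖ * ‖t‖ ^ n := by simp [hg']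
      _ ≤ (Fintype.card J * B ^ (n + 1)) * r ^ n :=
        mul_le_mul h1 (pow_le_pow_left₀ (norm_nonneg _) ht.le _) (by positivity) (by positivity)
      _ = _ := by rw [mul_pow]; ring
  have hsum : Summable fun n : ℕ => Fintype.card J * B * (r * B) ^ n :=
    (summable_geometric_of_lt_one (by positivity) hrB).mul_left _
  have h0 : (0 : ℂ) ∈ Metric.ball (0 : ℂ) r := by simpa using hr0
  have hS : ∀ t ∈ Metric.ball (0 : ℂ) r,
      HasDerivAt (fun z => ∑' n, g n z) (∑' n, g' n t) t := fun t ht =>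
    hasDerivAt_tsum_of_isPreconnected hsum Metric.isOpen_ball
      (convex_ball (0 : ℂ) r).isPreconnected hder hbound h0 (by simp [hg, summable_zero]) ht
  have hprod : ∀ t ∈ Metric.ball (0 : ℂ) r,
      HasDerivAt (fun z => Complex.exp (∑' n, g n z) * (1 - z • T).det) 0 t := by
    intro t ht
    obtain ⟨R, hRs, hR⟩ : ∃ R, HasSum (fun i : ℕ => (t • T) ^ i) R ∧ (1 - t • T) * R = 1 :=
      ⟨_, (summable_geometric_of_norm_lt_one (hsm t ht)).hasSum,
        mul_neg_geom_series (t • T) (hsm t ht)⟩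
    have htr : ∑' n, g' n t = (T * R).trace := by
      have : HasSum (fun i : ℕ => (T * (t • T) ^ i).trace) (T * R).trace :=
        (hRs.mul_left T).map (Matrix.traceAddMonoidHom J ℂ)
          (continuous_finsetSum _ fun i _ => continuous_id.matrix_elem i i)
      refine HasSum.tsum_eq ?_
      convert this using 2 with n
      simp only [hg', smul_pow, Matrix.mul_smul, Matrix.trace_smul, smul_eq_mul]
      rw [pow_succ' T, mul_comm]
    have h := (hS t ht).cexp.mul (hasDerivAt_det_one_sub_smul T _ t hR)
    refine h.congr_deriv ?_
    rw [htr]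
    ring
  have hconst := Metric.isOpen_ball.is_const_of_deriv_eq_zero
    (convex_ball (0 : ℂ) r).isPreconnected
    (fun t ht => (hprod t ht).differentiableAt.differentiableWithinAt)
    (fun t ht => (hprod t ht).deriv) (by simpa using hur : u ∈ Metric.ball (0 : ℂ) r) h0
  simpa [hg] using hconst

end TraceDet

/-! ### Cyclic words: powers, periods and weights -/

section Words

variable {E : Type*}

/-- The `m`-th power of a word. -/
def wordPow (m : ℕ) (p : List E) : List E := (List.replicate m p).flatten

@[simp] theorem wordPow_zero (p : List E) : wordPow 0 p = [] := by simp [wordPow]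

theorem wordPow_succ (m : ℕ) (p : List E) : wordPow (m + 1) p = p ++ wordPow m p := by
  simp [wordPow, List.replicate_succ]

@[simp] theorem length_wordPow (m : ℕ) (p : List E) : (wordPow m p).length = m * p.length := by
  simp [wordPow]

theorem wordPow_append (m : ℕ) (x y : List E) :
    wordPow m (x ++ y) ++ x = x ++ wordPow m (y ++ x) := by
  induction m with
  | zero => simp
  | succ m ih => rw [wordPow_succ, wordPow_succ, List.append_assoc, ih]; simp

theorem wordPow_inj {m : ℕ} {p q : List E} (hl : p.length = q.length)
    (h : wordPow (m + 1) p = wordPow (m + 1) q) : p = q := by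
  rw [wordPow_succ, wordPow_succ] at h
  exact (List.append_inj h hl).1

theorem rotate_one_wordPow (m : ℕ) (p : List E) :
    (wordPow m p).rotate 1 = wordPow m (p.rotate 1) := by
  rcases p with _ | ⟨a, l⟩
  · simp [wordPow]
  · rcases m with _ | m
    · simp
    · have h := wordPow_append (m + 1) [a] l
      rw [show [a] ++ l = a :: l from rfl, wordPow_succ] at h
      rw [wordPow_succ]
      simpa using h

theorem iterate_rotate_one (p : List E) (n : ℕ) :
    (fun l : List E => l.rotate 1)^[n] p = p.rotate n := by
  induction n with
  | zero => simp
  | succ n ih => rw [Function.iterate_succ_apply', ih, List.rotate_rotate]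

theorem rotate_wordPow (m k : ℕ) (p : List E) :
    (wordPow m p).rotate k = wordPow m (p.rotate k) := by
  induction k with
  | zero => simp
  | succ k ih => rw [← List.rotate_rotate, ih, rotate_one_wordPow, List.rotate_rotate]

/-- The smallest positive `k` such that the rotation of a word by `k` letters fixes the word. -/
noncomputable def wordPeriod (p : List E) : ℕ :=
  Function.minimalPeriod (fun l : List E => l.rotate 1) p

theorem rotate_eq_self_iff_dvd (p : List E) (k : ℕ) : p.rotate k = p ↔ wordPeriod p ∣ k := by
  rw [wordPeriod, ← Function.isPeriodicPt_iff_minimalPeriod_dvd, Function.IsPeriodicPt,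
    Function.IsFixedPt, iterate_rotate_one]

theorem wordPeriod_dvd_length (p : List E) : wordPeriod p ∣ p.length :=
  (rotate_eq_self_iff_dvd p _).1 p.rotate_length

theorem wordPeriod_pos {p : List E} (hp : p ≠ []) : 0 < wordPeriod p :=
  Nat.pos_of_dvd_of_pos (wordPeriod_dvd_length p) (List.length_pos_iff.2 hp)

theorem wordPeriod_eq_of_iff {p q : List E} (h : ∀ k, p.rotate k = p ↔ q.rotate k = q) :
    wordPeriod p = wordPeriod q := by
  rw [wordPeriod, wordPeriod, Function.minimalPeriod_eq_minimalPeriod_iff]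
  intro k
  simpa only [Function.IsPeriodicPt, Function.IsFixedPt, iterate_rotate_one] using h k

theorem wordPeriod_rotate (p : List E) (j : ℕ) : wordPeriod (p.rotate j) = wordPeriod p :=
  wordPeriod_eq_of_iff fun k => by
    rw [List.rotate_rotate, add_comm, ← List.rotate_rotate, List.rotate_eq_rotate]

theorem wordPeriod_wordPow (m : ℕ) (p : List E) :
    wordPeriod (wordPow (m + 1) p) = wordPeriod p :=
  wordPeriod_eq_of_iff fun k => by
    rw [rotate_wordPow]
    exact ⟨wordPow_inj (by simp), fun h => by rw [h]⟩

theorem rotate_inj_of_lt_wordPeriod {p : List E} {i j : ℕ} (hi : i < wordPeriod p)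
    (hj : j < wordPeriod p) (h : p.rotate i = p.rotate j) : i = j := by
  rw [← iterate_rotate_one, ← iterate_rotate_one] at h
  exact (Function.iterate_eq_iterate_iff_of_lt_minimalPeriod hi hj).1 h

/-- Two commuting words, the length of one being a multiple of the length of the other. -/
theorem eq_wordPow_of_append_comm (x : List E) :
    ∀ (k : ℕ) (y : List E), y.length = k * x.length → x ++ y = y ++ x → y = wordPow k x := by
  intro k
  induction k with
  | zero => intro y hy _; simpa using hy
  | succ k ih =>
    intro y hy h
    have hle : x.length ≤ y.length := by rw [hy]; nlinarith
    obtain ⟨z, rfl⟩ : x <+: y := by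
      have h1 : x <+: y ++ x := ⟨y, h⟩
      exact List.prefix_of_prefix_length_le h1 (List.prefix_append y x) hle
    rw [wordPow_succ, ← ih z]
    · have h2 : x.length + z.length = (k + 1) * x.length := by simpa using hy
      have : (k + 1) * x.length = k * x.length + x.length := by ring
      omega
    · simpa using h

/-- Every nonempty word is a power of its initial segment of length `wordPeriod`. -/
theorem eq_wordPow_take (p : List E) (hp : p ≠ []) :
    ∃ m, p = wordPow (m + 1) (p.take (wordPeriod p)) ∧
      (p.take (wordPeriod p)).length = wordPeriod p ∧
      wordPeriod (p.take (wordPeriod p)) = wordPeriod p := by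
  set d := wordPeriod p with hd
  have hpos : 0 < p.length := List.length_pos_iff.2 hp
  obtain ⟨k, hk⟩ := wordPeriod_dvd_length p
  have hdl : d ≤ p.length := Nat.le_of_dvd hpos (wordPeriod_dvd_length p)
  have hlen : (p.take d).length = d := by simp [hdl]
  rcases k with _ | m
  · simp [hk] at hpos
  have hrot : p.drop d ++ p.take d = p := by
    rw [← List.rotate_eq_drop_append_take hdl, rotate_eq_self_iff_dvd]
  have hdrop : p.drop d = wordPow m (p.take d) := by
    refine eq_wordPow_of_append_comm _ _ _ ?_ ?_
    · rw [List.length_drop, hlen, hk, ← hd, Nat.mul_succ, Nat.add_sub_cancel, mul_comm]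
    · rw [hrot, List.take_append_drop]
  have hpow : p = wordPow (m + 1) (p.take d) := by
    rw [wordPow_succ, ← hdrop, List.take_append_drop]
  refine ⟨m, hpow, hlen, ?_⟩
  rw [← wordPeriod_wordPow m, ← hpow]

variable {M : Type*}

/-- The weight of a cyclic word: the product of the weights of the pairs of cyclically consecutive
letters. -/
def closedWeight [Monoid M] (W : E → E → M) (p : List E) : M :=
  (List.zipWith W p (p.rotate 1)).prod

theorem closedWeight_rotate [CommMonoid M] (W : E → E → M) (p : List E) (n : ℕ) :
    closedWeight W (p.rotate n) = closedWeight W p := by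
  unfold closedWeight
  rw [List.rotate_rotate, Nat.add_comm, ← List.rotate_rotate,
    ← List.zipWith_rotate_distrib _ _ _ _ (by simp)]
  exact (List.rotate_perm _ n).prod_eq

theorem zipWith_wordPow (W : E → E → M) (m : ℕ) {p q : List E} (h : p.length = q.length) :
    List.zipWith W (wordPow m p) (wordPow m q) =
      (List.replicate m (List.zipWith W p q)).flatten := by
  induction m with
  | zero => simp
  | succ m ih =>
    rw [wordPow_succ, wordPow_succ, List.zipWith_append h, ih]; simp [List.replicate_succ]

theorem closedWeight_wordPow [Monoid M] (W : E → E → M) (m : ℕ) (p : List E) :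
    closedWeight W (wordPow m p) = closedWeight W p ^ m := by
  unfold closedWeight
  rw [rotate_one_wordPow, zipWith_wordPow W m (by simp), List.prod_flatten]
  simp

theorem closedWeight_hom {N : Type*} [Monoid M] [Monoid N] (φ : M →* N) (W : E → E → M)
    (p : List E) : closedWeight (fun a b => φ (W a b)) p = φ (closedWeight W p) := by
  unfold closedWeight
  rw [map_list_prod, List.map_zipWith]

theorem closedWeight_map [Monoid M] {J : Type*} (j : J → E) (W : E → E → M) (q : List J) :
    closedWeight W (q.map j) = closedWeight (fun a b => W (j a) (j b)) q := by
  unfold closedWeight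
  rw [← List.map_rotate, List.zipWith_map]

theorem closedWeight_congr [Monoid M] {W W' : E → E → M} {p : List E}
    (h : ∀ a ∈ p, ∀ b ∈ p, W a b = W' a b) : closedWeight W p = closedWeight W' p := by
  unfold closedWeight
  have : ∀ (l l' : List E), (∀ a ∈ l, a ∈ p) → (∀ a ∈ l', a ∈ p) →
      List.zipWith W l l' = List.zipWith W' l l' := by
    intro l
    induction l with
    | nil => simp
    | cons a l ih =>
      intro l' h1 h2
      rcases l' with _ | ⟨b, l'⟩
      · simp
      · simp only [List.mem_cons, forall_eq_or_imp] at h1 h2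
        rw [List.zipWith_cons_cons, List.zipWith_cons_cons, h a h1.1 b h2.1, ih l' h1.2 h2.2]
  rw [this p (p.rotate 1) (fun _ h => h) (fun _ h => List.mem_rotate.1 h)]

/-- The weight of the path from `a` to `b` through the letters of a list. -/
def chainWeight [Monoid M] (W : E → E → M) : E → List E → E → M
  | a, [], b => W a b
  | a, x :: l, b => W a x * chainWeight W x l b

theorem closedWeight_cons [Monoid M] (W : E → E → M) (a : E) (l : List E) :
    closedWeight W (a :: l) = chainWeight W a l a := by
  have h : ∀ (a b : E) (l : List E),
      (List.zipWith W (a :: l) (l ++ [b])).prod = chainWeight W a l b := by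
    intro a b l
    induction l generalizing a with
    | nil => simp [chainWeight]
    | cons x l ih => rw [List.cons_append, List.zipWith_cons_cons, List.prod_cons, ih]; rfl
  rw [← h]
  simp [closedWeight]

theorem closedWeight_eq_zero [CommMonoidWithZero M] {W : E → E → M} {p : List E} {e : E}
    (he : e ∈ p) (hW : ∀ e', W e e' = 0) : closedWeight W p = 0 := by
  obtain ⟨s, t, rfl⟩ := List.append_of_mem he
  rw [← closedWeight_rotate W _ s.length, List.rotate_append_length_eq, List.cons_append,
    closedWeight_cons]
  cases t ++ s <;> simp [chainWeight, hW]

theorem isChain_of_chainWeight_ne_zero [MonoidWithZero M] {W : E → E → M} {R : E → E → Prop}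
    (hW : ∀ a b, W a b ≠ 0 → R a b) (a b : E) (l : List E) (h : chainWeight W a l b ≠ 0) :
    List.IsChain R (a :: (l ++ [b])) := by
  induction l generalizing a with
  | nil => simpa [chainWeight] using hW a b h
  | cons x l ih =>
    rw [chainWeight] at h
    exact List.isChain_cons_cons.2 ⟨hW _ _ (left_ne_zero_of_mul h), ih x (right_ne_zero_of_mul h)⟩

theorem cycleChain_of_closedWeight_ne_zero [MonoidWithZero M] {W : E → E → M} {R : E → E → Prop}
    (hW : ∀ a b, W a b ≠ 0 → R a b) {p : List E} (h : closedWeight W p ≠ 0) :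
    Cycle.Chain R (p : Cycle E) := by
  rcases p with _ | ⟨a, l⟩
  · simp
  · rw [closedWeight_cons] at h
    rw [Cycle.chain_coe_cons]
    exact isChain_of_chainWeight_ne_zero hW _ _ _ h

open Classical in
/-- Being a closed path is the nonvanishing of a product over the consecutive pairs of letters; in
this form the condition is seen to be invariant under taking powers. -/
theorem cycleChain_iff_closedWeight (R : E → E → Prop) (p : List E) :
    Cycle.Chain R (p : Cycle E) ↔ closedWeight (fun a b => if R a b then (1 : ℕ) else 0) p ≠ 0 := by
  refine ⟨fun h => ?_, cycleChain_of_closedWeight_ne_zero (by simp)⟩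
  rcases p with _ | ⟨a, l⟩
  · simp [closedWeight]
  · rw [Cycle.chain_coe_cons] at h
    rw [closedWeight_cons]
    have : ∀ (a b : E) (l : List E), List.IsChain R (a :: (l ++ [b])) →
        chainWeight (fun a b => if R a b then (1 : ℕ) else 0) a l b ≠ 0 := by
      intro a b l
      induction l generalizing a with
      | nil => simp [chainWeight]
      | cons x l ih =>
        intro h
        rw [List.cons_append, List.isChain_cons_cons] at h
        rw [chainWeight, if_pos h.1, one_mul]
        exact ih x h.2
    exact this a a l h

theorem cycleChain_wordPow (R : E → E → Prop) (m : ℕ) (p : List E) :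
    Cycle.Chain R (wordPow (m + 1) p : Cycle E) ↔ Cycle.Chain R (p : Cycle E) := by
  rw [cycleChain_iff_closedWeight, cycleChain_iff_closedWeight, closedWeight_wordPow]
  exact pow_ne_zero_iff (Nat.succ_ne_zero m)

end Words

/-! ### Sums over words in a finite alphabet -/

section WordSums

variable {J : Type*} [Fintype J] [DecidableEq J]

theorem sum_chainWeight {R : Type*} [CommSemiring R] (T : Matrix J J R) (n : ℕ) (a b : J) :
    ∑ f : Fin n → J, chainWeight T a (List.ofFn f) b = (T ^ (n + 1)) a b := by
  induction n generalizing a with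
  | zero => simp [chainWeight]
  | succ n ih =>
    rw [← (Fin.consEquiv fun _ => J).sum_comp, Fintype.sum_prod_type, pow_succ', Matrix.mul_apply]
    refine Finset.sum_congr rfl fun x _ => ?_
    rw [← ih, Finset.mul_sum]
    refine Finset.sum_congr rfl fun f _ => ?_
    simp [Fin.consEquiv, chainWeight]

/-- The trace of a power of `T` is the sum over all cyclic words of that length with a marked
starting point. -/
theorem sum_closedWeight {R : Type*} [CommSemiring R] (T : Matrix J J R) (n : ℕ) :
    ∑ f : Fin (n + 1) → J, closedWeight T (List.ofFn f) = (T ^ (n + 1)).trace := by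
  rw [← (Fin.consEquiv fun _ => J).sum_comp, Fintype.sum_prod_type, Matrix.trace]
  refine Finset.sum_congr rfl fun x _ => ?_
  rw [Matrix.diag_apply, ← sum_chainWeight]
  refine Finset.sum_congr rfl fun f _ => ?_
  simpa [Fin.consEquiv] using closedWeight_cons T x (List.ofFn f)

/-- The contribution of a word to the logarithm of the zeta function; it vanishes on the empty
word, since `x / 0 = 0`. -/
noncomputable def wordTerm {E : Type*} (W : E → E → ℂ) (u : ℂ) (p : List E) : ℂ :=
  closedWeight W p * u ^ p.length / (p.length : ℂ)

open scoped Matrix.Norms.Operator in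
/-- The left-hand side is the trace of a power of the matrix of the absolute values of `T`. -/
theorem sum_norm_closedWeight_le {T : Matrix J J ℂ} {B : ℝ} (hB : 0 ≤ B)
    (hT : ∀ i, ∑ j, ‖T i j‖ ≤ B) (n : ℕ) :
    ∑ f : Fin (n + 1) → J, ‖closedWeight T (List.ofFn f)‖ ≤ Fintype.card J * B ^ (n + 1) := by
  set T' : Matrix J J ℂ := fun i j => ((‖T i j‖ : ℝ) : ℂ) with hT'
  have h1 : ∀ p : List J, ((‖closedWeight T p‖ : ℝ) : ℂ) = closedWeight T' p := by
    intro p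
    exact (closedWeight_hom ((Complex.ofRealHom : ℝ →* ℂ).comp
      (normHom : ℂ →*₀ ℝ).toMonoidHom) T p).symm
  have h2 : ((∑ f : Fin (n + 1) → J, ‖closedWeight T (List.ofFn f)‖ : ℝ) : ℂ)
      = (T' ^ (n + 1)).trace := by
    rw [← sum_closedWeight, Complex.ofReal_sum]
    exact Finset.sum_congr rfl fun f _ => h1 _
  have hTB : ‖T'‖ ≤ B := norm_le_of_rowSum_le hB fun i => by simpa [hT'] using hT i
  have h3 := norm_trace_le (T' ^ (n + 1))
  rw [← h2, Complex.norm_real, Real.norm_of_nonneg (Finset.sum_nonneg fun _ _ => norm_nonneg _)]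
    at h3
  exact h3.trans (mul_le_mul_of_nonneg_left
    ((norm_pow_le' T' n.succ_pos).trans (pow_le_pow_left₀ (norm_nonneg _) hTB _))
    (Nat.cast_nonneg _))

/-- The terms of all words sum up, absolutely, to a logarithm of `1 / det (1 - u T)`. -/
theorem exists_hasSum_wordTerm {T : Matrix J J ℂ} {B : ℝ} (hB : 0 < B)
    (hT : ∀ i, ∑ j, ‖T i j‖ ≤ B) {u : ℂ} (hu : ‖u‖ * B < 1) :
    ∃ L : ℂ, HasSum (wordTerm T u) L ∧ Complex.exp L * (1 - u • T).det = 1 := by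
  refine ⟨_, ?_, exp_tsum_trace_mul_det hB hT hu⟩
  -- the words are sorted by their lengths
  set e := (List.equivSigmaTuple (α := J)).symm with he
  have heq : ∀ n (f : Fin n → J), e ⟨n, f⟩ = List.ofFn f := fun _ _ => rfl
  have hsum : Summable (wordTerm T u ∘ e) := by
    refine Summable.of_norm ?_
    rw [summable_sigma_of_nonneg fun _ => norm_nonneg _]
    refine ⟨fun n => Summable.of_finite, ?_⟩
    rw [← summable_nat_add_iff 1]
    refine Summable.of_nonneg_of_le (fun n => tsum_nonneg fun _ => norm_nonneg _) (fun n => ?_)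
      ((summable_geometric_of_lt_one (by positivity) hu).mul_left (Fintype.card J * (‖u‖ * B)))
    rw [tsum_fintype]
    calc ∑ f : Fin (n + 1) → J, ‖(wordTerm T u ∘ e) ⟨n + 1, f⟩‖
        ≤ ∑ f : Fin (n + 1) → J, ‖closedWeight T (List.ofFn f)‖ * ‖u‖ ^ (n + 1) := by
          refine Finset.sum_le_sum fun f _ => ?_
          have hterm : (wordTerm T u ∘ e) ⟨n + 1, f⟩
              = closedWeight T (List.ofFn f) * u ^ (n + 1) / ((n + 1 : ℕ) : ℂ) := by
            rw [Function.comp_apply, heq]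
            simp only [wordTerm, List.length_ofFn]
          rw [hterm, norm_div, norm_mul, norm_pow]
          refine div_le_self (by positivity) ?_
          rw [Complex.norm_natCast]
          exact_mod_cast Nat.succ_pos n
      _ ≤ (Fintype.card J * B ^ (n + 1)) * ‖u‖ ^ (n + 1) := by
          rw [← Finset.sum_mul]
          exact mul_le_mul_of_nonneg_right (sum_norm_closedWeight_le hB.le hT n) (by positivity)
      _ = Fintype.card J * (‖u‖ * B) * (‖u‖ * B) ^ n := by ring
  have hfib : ∀ n, HasSum (fun f : Fin n → J => (wordTerm T u ∘ e) ⟨n, f⟩)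
      (if n = 0 then 0 else (T ^ n).trace * u ^ n / (n : ℂ)) := by
    intro n
    convert hasSum_fintype (fun f : Fin n → J => (wordTerm T u ∘ e) ⟨n, f⟩)
    rcases n with _ | n
    · simp [heq, wordTerm]
    · rw [if_neg n.succ_ne_zero, ← sum_closedWeight, Finset.sum_mul, Finset.sum_div]
      exact Finset.sum_congr rfl fun f _ => by simp [heq, wordTerm]
  have h := hsum.hasSum
  have h' := h.sigma hfib
  rw [← e.hasSum_iff]
  convert h
  rw [← h'.tsum_eq, h'.summable.tsum_eq_zero_add]
  simp

/-- The same sum over all words in a possibly infinite alphabet, for weights that vanish off a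
finite set of letters. -/
theorem exists_hasSum_wordTerm_of_injective {E : Type*} (W : E → E → ℂ) (j : J → E)
    (hj : Function.Injective j) (hW : ∀ e ∉ Set.range j, ∀ e', W e e' = 0) {B : ℝ} (hB : 0 < B)
    (hT : ∀ i, ∑ i', ‖W (j i) (j i')‖ ≤ B) {u : ℂ} (hu : ‖u‖ * B < 1) :
    ∃ L : ℂ, HasSum (wordTerm W u) L ∧
      Complex.exp L * (1 - u • (Matrix.of fun i i' => W (j i) (j i'))).det = 1 := by
  obtain ⟨L, hL, hdet⟩ := exists_hasSum_wordTerm (T := Matrix.of fun i i' => W (j i) (j i'))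
    hB hT hu
  refine ⟨L, ?_, hdet⟩
  rw [← (List.map_injective_iff.2 hj).hasSum_iff]
  · have : wordTerm W u ∘ List.map j = wordTerm (Matrix.of fun i i' => W (j i) (j i')) u := by
      funext q
      simp only [Function.comp_apply, wordTerm, closedWeight_map, List.length_map]
      rfl
    rwa [this]
  · intro p hp
    rw [Set.range_list_map] at hp
    simp only [Set.mem_ofPred_eq, not_forall] at hp
    obtain ⟨e, he, hne⟩ := hp
    rw [wordTerm, closedWeight_eq_zero he (hW e hne), zero_mul, zero_div]

end WordSums

/-! ### Words and prime cycles -/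

section Prime

variable {V : Type*} {Y : SimpleGraph V} {Γ : Type*} [Group Γ] {α : Γ →* (Y ≃g Y)}

/-- A closed path representing a prime cycle. -/
noncomputable def PrimeCycle.word (c : PrimeCycle α) : List (QEdge α) := Quotient.out c.1

theorem PrimeCycle.coe_word (c : PrimeCycle α) :
    ((c.word : List (QEdge α)) : Cycle (QEdge α)) = c.1 :=
  Quotient.out_eq c.1

theorem PrimeCycle.length_word (c : PrimeCycle α) : c.word.length = c.length := by
  rw [PrimeCycle.length, ← c.coe_word]; rfl

theorem PrimeCycle.word_ne_nil (c : PrimeCycle α) : c.word ≠ [] := by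
  intro h
  have := c.2.1.1
  rw [← c.coe_word, h] at this
  exact this rfl

theorem PrimeCycle.length_pos (c : PrimeCycle α) : 0 < c.length := by
  rw [← c.length_word]; exact List.length_pos_iff.2 c.word_ne_nil

/-- A cycle of `X` is prime if and only if the rotations of a representing word are pairwise
distinct. -/
theorem isPrimeCycle_coe_iff (p : List (QEdge α)) :
    IsPrimeCycle (p : Cycle (QEdge α)) ↔
      IsGraphCycle (p : Cycle (QEdge α)) ∧ wordPeriod p = p.length := by
  refine ⟨fun ⟨h, hp⟩ => ⟨h, ?_⟩, fun ⟨h, hp⟩ => ⟨h, fun q m hq hl heq => ?_⟩⟩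
  · have hne : p ≠ [] := fun h0 => h.1 (by rw [h0]; rfl)
    obtain ⟨m, hm, hlen, -⟩ := eq_wordPow_take p hne
    by_contra hcon
    have hle := Nat.le_of_dvd (List.length_pos_iff.2 hne) (wordPeriod_dvd_length p)
    refine hp (p.take (wordPeriod p)) (m + 1) ⟨?_, ?_⟩ ?_ (congrArg _ hm)
    · rw [Ne, Cycle.coe_eq_nil, ← List.length_eq_zero_iff, hlen]
      exact (wordPeriod_pos hne).ne'
    · rw [← cycleChain_wordPow _ m, ← hm]
      exact h.2
    · rw [hlen, Cycle.length_coe]; omega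
  · rcases m with _ | m
    · exact h.1 heq
    · obtain ⟨k, hk⟩ := (Cycle.coe_eq_coe.1 heq).symm
      have h1 : wordPeriod p = wordPeriod q := by
        rw [← hk, wordPeriod_rotate]
        exact wordPeriod_wordPow m q
      have hqne : q ≠ [] := fun h0 => hq.1 (by rw [h0]; rfl)
      have h2 := Nat.le_of_dvd (List.length_pos_iff.2 hqne) (wordPeriod_dvd_length q)
      rw [Cycle.length_coe] at hl
      omega

theorem PrimeCycle.wordPeriod_word (c : PrimeCycle α) : wordPeriod c.word = c.length := by
  have h := c.2
  rw [← c.coe_word] at h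
  rw [((isPrimeCycle_coe_iff _).1 h).2, c.length_word]

/-- The word obtained by running `m + 1` times through a prime cycle, starting at its `i`-th
edge. -/
noncomputable def primeWord (x : Σ c : PrimeCycle α, Fin c.length × ℕ) : List (QEdge α) :=
  wordPow (x.2.2 + 1) (x.1.word.rotate x.2.1)

/-- A word determines the prime cycle of which it is a power, the exponent and the starting edge:
the length of the cycle is the period of the word. -/
theorem primeWord_injective : Function.Injective (primeWord (α := α)) := by
  rintro ⟨c, i, m⟩ ⟨d, k, n⟩ h
  change wordPow (m + 1) (c.word.rotate i) = wordPow (n + 1) (d.word.rotate k) at h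
  have hper := congrArg wordPeriod h
  rw [wordPeriod_wordPow, wordPeriod_wordPow, wordPeriod_rotate, wordPeriod_rotate,
    c.wordPeriod_word, d.wordPeriod_word] at hper
  have hlen := congrArg List.length h
  simp only [length_wordPow, List.length_rotate, PrimeCycle.length_word, hper] at hlen
  obtain rfl : m = n := by
    have := Nat.eq_of_mul_eq_mul_right d.length_pos hlen
    omega
  have hrot := wordPow_inj (by simp [PrimeCycle.length_word, hper]) h
  obtain rfl : c = d := by
    apply Subtype.ext
    rw [← c.coe_word, ← d.coe_word, Cycle.coe_eq_coe]
    exact ((List.IsRotated.forall c.word i).symm.trans ⟨0, by rw [hrot, List.rotate_zero]⟩).trans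
      (List.IsRotated.forall d.word k)
  obtain rfl : i = k := Fin.ext (rotate_inj_of_lt_wordPeriod
    (by rw [c.wordPeriod_word]; exact i.2) (by rw [c.wordPeriod_word]; exact k.2) hrot)
  rfl

/-- Every closed path of `X` is a power of a prime cycle, read from some starting edge. -/
theorem mem_range_primeWord {p : List (QEdge α)} (hp : IsGraphCycle (p : Cycle (QEdge α))) :
    p ∈ Set.range (primeWord (α := α)) := by
  have hne : p ≠ [] := fun h0 => hp.1 (by rw [h0]; rfl)
  obtain ⟨m, hm, hlen, hper⟩ := eq_wordPow_take p hne
  set q := p.take (wordPeriod p)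
  have hq : IsPrimeCycle (q : Cycle (QEdge α)) := by
    rw [isPrimeCycle_coe_iff, hlen, hper]
    refine ⟨⟨?_, ?_⟩, rfl⟩
    · rw [Ne, Cycle.coe_eq_nil, ← List.length_eq_zero_iff, hlen]
      exact (wordPeriod_pos hne).ne'
    · rw [← cycleChain_wordPow _ m, ← hm]
      exact hp.2
  let c : PrimeCycle α := ⟨q, hq⟩
  obtain ⟨k, hk⟩ : c.word ~r q := Cycle.coe_eq_coe.1 c.coe_word
  refine ⟨⟨c, ⟨k % c.length, Nat.mod_lt _ c.length_pos⟩, m⟩, ?_⟩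
  change wordPow (m + 1) (c.word.rotate (k % c.length)) = p
  rw [← c.length_word, List.rotate_mod, hk, ← hm]

/-- Grouping the words by the prime cycles of which they are powers turns the sum over words into
the logarithm of the Euler product. -/
theorem hasSum_neg_log_of_hasSum_wordTerm {W : QEdge α → QEdge α → ℂ}
    (hW : ∀ e e', W e e' ≠ 0 → e.terminus = e'.origin) {u : ℂ}
    (hu : ∀ c : PrimeCycle α, ‖closedWeight W c.word * u ^ c.length‖ < 1) {L : ℂ}
    (hL : HasSum (wordTerm W u) L) :
    HasSum (fun c : PrimeCycle α => -Complex.log (1 - closedWeight W c.word * u ^ c.length)) L := by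
  rw [← primeWord_injective.hasSum_iff] at hL
  · refine hL.sigma fun c => ?_
    have hc : (c.length : ℂ) ≠ 0 := by exact_mod_cast c.length_pos.ne'
    set z := closedWeight W c.word * u ^ c.length with hz
    have hterm : ∀ (i : Fin c.length) (m : ℕ), (wordTerm W u ∘ primeWord) ⟨c, i, m⟩
        = z ^ (m + 1) / ((m : ℂ) + 1) / c.length := by
      intro i m
      simp only [Function.comp_apply, wordTerm, primeWord, closedWeight_wordPow,
        closedWeight_rotate, length_wordPow, List.length_rotate, PrimeCycle.length_word, hz]
      rw [mul_pow, ← pow_mul, mul_comm c.length (m + 1), div_div]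
      push_cast
      rfl
    have hin : ∀ i : Fin c.length, HasSum (fun m => (wordTerm W u ∘ primeWord) ⟨c, i, m⟩)
        (-Complex.log (1 - z) / c.length) := by
      intro i
      simp only [hterm]
      exact (Complex.hasSum_taylorSeries_neg_log' (hu c)).div_const _
    have hs := (hL.summable.sigma_factor c).hasSum
    -- the `c.length` starting edges cancel the denominators `c.length` of the terms
    have h1 := hs.prod_fiberwise hin
    have h2 : ∑' b : Fin c.length × ℕ, (wordTerm W u ∘ primeWord) ⟨c, b⟩
        = -Complex.log (1 - z) := by
      rw [← h1.tsum_eq, tsum_fintype]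
      simp
      field_simp
    rwa [h2] at hs
  · intro p hp
    by_contra hne
    refine hp (mem_range_primeWord ⟨?_, ?_⟩)
    · rw [Ne, Cycle.coe_eq_nil]
      rintro rfl
      simp [wordTerm] at hne
    · refine cycleChain_of_closedWeight_ne_zero hW fun h0 => hne ?_
      rw [wordTerm, h0, zero_mul, zero_div]

end Prime

/-! ### Elimination of the cusps from the determinant -/

section CuspDet

/-- A matrix all of whose transitions raise a height function `b` is nilpotent. -/
theorem det_one_sub_smul_eq_one {n : Type*} [Fintype n] [DecidableEq n] (D : Matrix n n ℂ)
    (b : n → ℕ) (hD : ∀ x y, D x y ≠ 0 → b x < b y) (u : ℂ) : (1 - u • D).det = 1 := by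
  have hz : ∀ x y, b y ≤ b x → D x y = 0 := fun x y h => by
    by_contra h0
    exact absurd (hD x y h0) (not_lt.2 h)
  have hbt : (1 - u • D).BlockTriangular b := by
    intro x y hxy
    have hne : x ≠ y := by rintro rfl; exact lt_irrefl _ hxy
    simp [hne, hz x y hxy.le]
  rw [hbt.det]
  refine Finset.prod_eq_one fun k _ => ?_
  have : (1 - u • D).toSquareBlock b k = 1 := by
    ext ⟨x, hx⟩ ⟨y, hy⟩
    simp [Matrix.toSquareBlock_def, hz x y (by rw [hx, hy]), Matrix.one_apply]
  rw [this, Matrix.det_one]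

variable {F ι : Type*} [Fintype F] [DecidableEq F] [Fintype ι] [DecidableEq ι]

/-- The transitions inside the cusps cut off at height `K`. The index `Sum.inl (i, n)` stands for
the ascending edge of height `n + 1` of the cusp `i`, and `Sum.inr (i, n)` for its reverse. -/
def cuspBlock (K : ℕ) (c d : ι → ℕ → ℂ) :
    Matrix (ι × Fin K ⊕ ι × Fin K) (ι × Fin K ⊕ ι × Fin K) ℂ :=
  Matrix.of fun
    | .inl x, .inl y => if y.1 = x.1 ∧ (y.2 : ℕ) = x.2 + 1 then 1 else 0
    | .inl x, .inr y => if y = x then d x.1 x.2 else 0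
    | .inr _, .inl _ => 0
    | .inr x, .inr y => if y.1 = x.1 ∧ (x.2 : ℕ) = y.2 + 1 then c x.1 x.2 else 0

/-- The transitions from the finite part into the cusps; the cusp `i` is entered from the edge
`a i`. -/
def enterBlock (K : ℕ) (a : ι → F) : Matrix F (ι × Fin K ⊕ ι × Fin K) ℂ :=
  Matrix.of fun
    | f, .inl y => if f = a y.1 ∧ (y.2 : ℕ) = 0 then 1 else 0
    | _, .inr _ => 0

/-- The transitions from the cusps back to the finite part; the cusp `i` is left through the edge
`b i`. -/
def leaveBlock (K : ℕ) (b : ι → F) (c : ι → ℕ → ℂ) : Matrix (ι × Fin K ⊕ ι × Fin K) F ℂ :=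
  Matrix.of fun
    | .inl _, _ => 0
    | .inr x, f => if f = b x.1 ∧ (x.2 : ℕ) = 0 then c x.1 x.2 else 0

/-- The generating function of the excursions into a cusp of height at most `K`. -/
noncomputable def excursion (c d : ℕ → ℂ) (K : ℕ) (u : ℂ) : ℂ :=
  ∑ m ∈ Finset.range K, u ^ (2 * m + 2) * d m * ∏ j ∈ Finset.range (m + 1), c j

theorem sum_fin_ite_eq (K m : ℕ) (φ : ℕ → ℂ) (hφ : K ≤ m → φ m = 0) :
    ∑ n : Fin K, (if (n : ℕ) = m then φ n else 0) = φ m := by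
  by_cases hm : m < K
  · rw [Finset.sum_eq_single (⟨m, hm⟩ : Fin K)]
    · simp
    · intro n _ hn
      exact if_neg fun h => hn (Fin.ext h)
    · simp
  · rw [hφ (not_lt.1 hm)]
    exact Finset.sum_eq_zero fun n _ => if_neg fun h => hm (by rw [← h]; exact n.2)

/-- Eliminating the cusps: their contribution to the determinant amounts to one additional entry
for each cusp, the generating function of the excursions. -/
theorem det_cusp_elimination (A : Matrix F F ℂ) (K : ℕ) (a b : ι → F) (c d : ι → ℕ → ℂ) (u : ℂ) :
    (1 - u • Matrix.fromBlocks A (enterBlock K a) (leaveBlock K b c) (cuspBlock K c d)).det =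
      (1 - u • A - Matrix.of fun f f' => ∑ i, if f = a i ∧ f' = b i
        then u * excursion (c i) (d i) K u else 0).det := by
  set D := cuspBlock K c d with hD
  have hdetD : (1 - u • D).det = 1 := by
    -- along a path through the cusp one first ascends, turns at most once, and then descends
    refine det_one_sub_smul_eq_one D (Sum.elim (fun x => (x.2 : ℕ)) fun x => 2 * K - x.2) ?_ u
    rintro (⟨i, n⟩ | ⟨i, n⟩) (⟨i', n'⟩ | ⟨i', n'⟩) h <;>
      simp only [hD, cuspBlock, Matrix.of_apply, ne_eq, ite_eq_right_iff, not_forall,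
        Prod.mk.injEq, Sum.elim_inl, Sum.elim_inr] at h ⊢
    · obtain ⟨⟨-, h⟩, -⟩ := h
      omega
    · obtain ⟨⟨-, rfl⟩, -⟩ := h
      have := n'.2
      omega
    · exact (h trivial).elim
    · obtain ⟨⟨-, h⟩, -⟩ := h
      have := n.2
      omega
  -- the generating functions of the paths back to the finite part, `p` from a descending edge and
  -- `s` from an ascending edge
  set p : ι → ℕ → ℂ := fun i n => u ^ (n + 1) * ∏ j ∈ Finset.range (n + 1), c i j with hp
  set s : ι → ℕ → ℂ := fun i n =>
    ∑ m ∈ Finset.range (K - n), u ^ m * (u * d i (n + m) * p i (n + m)) with hs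
  have hsK : ∀ i n, K ≤ n → s i n = 0 := fun i n h => by simp [hs, Nat.sub_eq_zero_of_le h]
  have hs1 : ∀ i n, n < K → s i n = u * s i (n + 1) + u * (d i n * p i n) := by
    intro i n hn
    simp only [hs]
    rw [show K - n = (K - (n + 1)) + 1 by omega, Finset.sum_range_succ', Finset.mul_sum]
    congr 1
    · refine Finset.sum_congr rfl fun m _ => ?_
      rw [show n + (m + 1) = n + 1 + m by ring]
      ring
    · simp; ring
  -- `Z = (1 - u D)⁻¹ (u C)`, where `C` is the block of the transitions out of the cusps
  let Z : Matrix (ι × Fin K ⊕ ι × Fin K) F ℂ := Matrix.of fun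
    | .inl x, f => if f = b x.1 then s x.1 x.2 else 0
    | .inr x, f => if f = b x.1 then p x.1 x.2 else 0
  have hZ : (1 - u • D) * Z = u • leaveBlock K b c := by
    rw [Matrix.sub_mul, Matrix.one_mul, Matrix.smul_mul, sub_eq_iff_eq_add, ← smul_add]
    ext (⟨i, n⟩ | ⟨i, n⟩) f
    · have h1 : ∑ x : ι × Fin K, D (.inl (i, n)) (.inl x) * Z (.inl x) f
          = if f = b i then s i (n + 1) else 0 := by
        rw [Fintype.sum_prod_type, Finset.sum_eq_single i]
        · rw [← sum_fin_ite_eq K (n + 1) (fun m => if f = b i then s i m else 0)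
            (fun h => by simp [hsK i _ h])]
          refine Finset.sum_congr rfl fun m _ => ?_
          simp only [hD, cuspBlock, Z, Matrix.of_apply, true_and]
          split_ifs <;> simp
        · intro i' _ hi'
          exact Finset.sum_eq_zero fun m _ => by simp [hD, cuspBlock, hi']
        · simp
      have h2 : ∑ x : ι × Fin K, D (.inl (i, n)) (.inr x) * Z (.inr x) f
          = if f = b i then d i n * p i n else 0 := by
        rw [Finset.sum_eq_single (i, n)]
        · simp [hD, cuspBlock, Z]
        · intro x _ hx
          simp [hD, cuspBlock, hx]
        · simp
      rw [Matrix.smul_apply, Matrix.add_apply, Matrix.mul_apply, Fintype.sum_sum_type, h1, h2]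
      simp only [Z, leaveBlock, Matrix.of_apply, zero_add, smul_eq_mul]
      split_ifs
      · rw [hs1 i n n.2]; ring
      · simp
    · have h1 : ∑ x : ι × Fin K, D (.inr (i, n)) (.inl x) * Z (.inl x) f = 0 :=
        Finset.sum_eq_zero fun x _ => by simp [hD, cuspBlock]
      have h2 : ∑ x : ι × Fin K, D (.inr (i, n)) (.inr x) * Z (.inr x) f
          = if f = b i ∧ (n : ℕ) ≠ 0 then c i n * p i (n - 1) else 0 := by
        rw [Fintype.sum_prod_type, Finset.sum_eq_single i]
        · by_cases h0 : (n : ℕ) = 0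
          · rw [if_neg (by simp [h0])]
            exact Finset.sum_eq_zero fun m _ => by simp [hD, cuspBlock, h0]
          · have h3 := sum_fin_ite_eq K (n - 1) (fun m => if f = b i then c i n * p i m else 0)
              (fun h => by have := n.2; omega)
            have h4 : (if f = b i ∧ (n : ℕ) ≠ 0 then c i n * p i (n - 1) else 0)
                = if f = b i then c i n * p i (n - 1) else 0 := by simp [h0]
            rw [h4, ← h3]
            refine Finset.sum_congr rfl fun m _ => ?_
            have h5 : (n : ℕ) = m + 1 ↔ (m : ℕ) = n - 1 := by omega
            simp only [hD, cuspBlock, Z, Matrix.of_apply, true_and, h5]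
            split_ifs <;> simp
        · intro i' _ hi'
          exact Finset.sum_eq_zero fun m _ => by simp [hD, cuspBlock, hi']
        · simp
      rw [Matrix.smul_apply, Matrix.add_apply, Matrix.mul_apply, Fintype.sum_sum_type, h1, h2]
      simp only [Z, leaveBlock, Matrix.of_apply, zero_add, smul_eq_mul]
      by_cases hf : f = b i
      · rcases hn : (n : ℕ) with _ | m
        · simp [hf, hp]
        · simp only [hf, hp, true_and, ne_eq, Nat.succ_ne_zero, not_false_eq_true, if_true,
            if_false, Nat.add_sub_cancel, zero_add]
          rw [Finset.prod_range_succ _ (m + 1)]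
          ring
      · simp [hf]
  have hBZ : u • (enterBlock K a * Z) = Matrix.of fun f f' => ∑ i, if f = a i ∧ f' = b i
        then u * excursion (c i) (d i) K u else 0 := by
    ext f f'
    have h0 : ∀ i, s i 0 = excursion (c i) (d i) K u := by
      intro i
      simp only [hs, hp, excursion, Nat.sub_zero, zero_add]
      refine Finset.sum_congr rfl fun m _ => ?_
      ring
    rw [Matrix.smul_apply, Matrix.mul_apply, Fintype.sum_sum_type, Fintype.sum_prod_type]
    have h2 : ∑ x : ι × Fin K, enterBlock K a f (.inr x) * Z (.inr x) f' = 0 :=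
      Finset.sum_eq_zero fun x _ => by simp [enterBlock]
    rw [h2, add_zero, smul_eq_mul, Finset.mul_sum, Matrix.of_apply]
    refine Finset.sum_congr rfl fun i _ => ?_
    have h3 := sum_fin_ite_eq K 0 (fun m => if f = a i ∧ f' = b i then s i m else 0)
      (fun h => by simp [hsK i _ h])
    rw [← h0, ← mul_ite_zero, ← h3]
    congr 1
    refine Finset.sum_congr rfl fun m _ => ?_
    simp only [enterBlock, Z, Matrix.of_apply, ite_mul, one_mul, zero_mul]
    split_ifs <;> simp_all
  -- clearing the lower left block leaves the Schur complement of `1 - u D`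
  have hfac : (1 - u • Matrix.fromBlocks A (enterBlock K a) (leaveBlock K b c) D)
      * Matrix.fromBlocks 1 0 Z 1
      = Matrix.fromBlocks (1 - u • A - u • (enterBlock K a * Z)) (-(u • enterBlock K a)) 0
        (1 - u • D) := by
    have h1 : (1 - u • Matrix.fromBlocks A (enterBlock K a) (leaveBlock K b c) D)
        = Matrix.fromBlocks (1 - u • A) (-(u • enterBlock K a)) (-(u • leaveBlock K b c))
          (1 - u • D) := by
      rw [← Matrix.fromBlocks_one, Matrix.fromBlocks_smul, sub_eq_add_neg, Matrix.fromBlocks_neg,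
        Matrix.fromBlocks_add]
      simp [sub_eq_add_neg]
    rw [h1, Matrix.fromBlocks_multiply, hZ]
    simp [sub_eq_add_neg]
  have hdet := congrArg Matrix.det hfac
  rw [Matrix.det_mul, Matrix.det_fromBlocks_zero₁₂, Matrix.det_fromBlocks_zero₂₁, hdetD] at hdet
  simpa [hBZ] using hdet

end CuspDet

/-! ### The Euler product as a limit over finite subgraphs -/

section Limit

open Filter Topology

theorem closedWeight_nonneg {E : Type*} {W : E → E → ℝ} (hW : ∀ e e', 0 ≤ W e e') (p : List E) :
    0 ≤ closedWeight W p := by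
  refine List.prod_nonneg fun x hx => ?_
  obtain ⟨i, hi, rfl⟩ := List.getElem_of_mem hx
  simp [hW]

theorem closedWeight_le_pow {E : Type*} {W : E → E → ℝ} {B : ℝ} (hW : ∀ e e', 0 ≤ W e e')
    (hWB : ∀ e e', W e e' ≤ B) (p : List E) : closedWeight W p ≤ B ^ p.length := by
  have h : ∀ l l' : List E, l.length = l'.length → (List.zipWith W l l').prod ≤ B ^ l.length := by
    intro l
    induction l with
    | nil => simp
    | cons a l ih =>
      rintro (_ | ⟨b, l'⟩) h
      · simp at h
      · rw [List.zipWith_cons_cons, List.prod_cons, List.length_cons, pow_succ']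
        refine mul_le_mul (hWB a b) (ih l' (by simpa using h)) (List.prod_nonneg fun x hx => ?_)
          ((hW a b).trans (hWB a b))
        obtain ⟨i, hi, rfl⟩ := List.getElem_of_mem hx
        simp [hW]
  exact h p _ (by simp)

variable {V : Type*} {Y : SimpleGraph V} {Γ : Type*} [Group Γ] {α : Γ →* (Y ≃g Y)}

/-- If the determinants of the finite truncations converge near the origin to a function without
zeros, then the Euler product converges unconditionally to its reciprocal. -/
theorem hasProd_of_tendsto_det (W : QEdge α → QEdge α → ℝ) (hW0 : ∀ e e', 0 ≤ W e e')
    (hWR : ∀ e e', W e e' ≠ 0 → e.terminus = e'.origin)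
    {J : ℕ → Type*} [∀ K, Fintype (J K)] [∀ K, DecidableEq (J K)] (j : ∀ K, J K → QEdge α)
    (hj : ∀ K, Function.Injective (j K)) (hex : ∀ e, ∀ᶠ K in atTop, e ∈ Set.range (j K))
    {B : ℝ} (hB : 0 < B) (hrow : ∀ K i, ∑ i', W (j K i) (j K i') ≤ B)
    {P : ℂ → ℂ} {ε : ℝ}
    (hP : ∀ u : ℂ, ‖u‖ < ε → Tendsto (fun K => (1 - u • (Matrix.of fun i i' =>
      ((W (j K i) (j K i') : ℝ) : ℂ))).det) atTop (𝓝 (P u)))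
    (hP0 : ∀ u : ℂ, ‖u‖ < ε → P u ≠ 0) {u : ℂ} (huε : ‖u‖ < ε) (huB : ‖u‖ * B ≤ 1 / 2) :
    (∀ c : PrimeCycle α, ‖((closedWeight W c.word : ℝ) : ℂ) * u ^ c.length‖ ≤ 1 / 2) ∧
      HasProd (fun c : PrimeCycle α => (1 - ((closedWeight W c.word : ℝ) : ℂ) * u ^ c.length)⁻¹)
        (P u)⁻¹ := by
  classical
  have hWB : ∀ e e', W e e' ≤ B := by
    intro e e'
    obtain ⟨K, ⟨i, rfl⟩, ⟨i', rfl⟩⟩ := ((hex e).and (hex e')).exists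
    exact (Finset.single_le_sum (f := fun i' => W (j K i) (j K i')) (fun _ _ => hW0 _ _)
      (Finset.mem_univ i')).trans (hrow K i)
  set w : PrimeCycle α → ℝ := fun c => closedWeight W c.word with hw
  -- the weights cut off outside the `K`-th finite set of edges
  let WK : ℕ → QEdge α → QEdge α → ℝ := fun K e e' =>
    if e ∈ Set.range (j K) ∧ e' ∈ Set.range (j K) then W e e' else 0
  have hWK0 : ∀ K e e', 0 ≤ WK K e e' := fun K e e' => by
    simp only [WK]; split_ifs; exacts [hW0 _ _, le_rfl]
  set wK : ℕ → PrimeCycle α → ℝ := fun K c => closedWeight (WK K) c.word with hwK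
  have hw0 : ∀ c, 0 ≤ w c := fun c => closedWeight_nonneg hW0 _
  have hwK0 : ∀ K c, 0 ≤ wK K c := fun K c => closedWeight_nonneg (hWK0 K) _
  have hwK_eq : ∀ K (c : PrimeCycle α), (∀ e ∈ c.word, e ∈ Set.range (j K)) → wK K c = w c :=
    fun K c h => closedWeight_congr fun a ha b hb => if_pos ⟨h a ha, h b hb⟩
  have hwK_le : ∀ K c, wK K c ≤ w c := by
    intro K c
    by_cases h : ∀ e ∈ c.word, e ∈ Set.range (j K)
    · exact (hwK_eq K c h).le
    · push Not at h
      obtain ⟨e, he, hne⟩ := h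
      have : wK K c = 0 := closedWeight_eq_zero he fun e' => if_neg fun h' => hne h'.1
      rw [this]
      exact hw0 c
  have hwK_ev : ∀ c, ∀ᶠ K in atTop, wK K c = w c := by
    intro c
    have : ∀ᶠ K in atTop, ∀ e ∈ {e | e ∈ c.word}, e ∈ Set.range (j K) :=
      (eventually_all_finite (List.finite_toSet c.word)).2 fun e _ => hex e
    exact this.mono fun K h => hwK_eq K c h
  have hsmall : ∀ r : ℝ, 0 ≤ r → r * B ≤ 1 / 2 → ∀ c, w c * r ^ c.length ≤ 1 / 2 := by
    intro r hr hrB c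
    calc w c * r ^ c.length ≤ B ^ c.length * r ^ c.length := by
          refine mul_le_mul_of_nonneg_right ?_ (by positivity)
          rw [← c.length_word]
          exact closedWeight_le_pow hW0 hWB _
      _ = (r * B) ^ c.length := by rw [mul_pow, mul_comm]
      _ ≤ (1 / 2) ^ c.length := pow_le_pow_left₀ (by positivity) hrB _
      _ ≤ (1 / 2) ^ 1 := pow_le_pow_of_le_one (by norm_num) (by norm_num) c.length_pos
      _ = 1 / 2 := pow_one _
  have hnorm : ∀ (x : ℝ) (v : ℂ) (n : ℕ), 0 ≤ x → ‖(x : ℂ) * v ^ n‖ = x * ‖v‖ ^ n := by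
    intro x v n hx
    rw [norm_mul, Complex.norm_real, Real.norm_of_nonneg hx, norm_pow]
  -- the identity for the truncated weights
  have hfin : ∀ (v : ℂ), ‖v‖ * B ≤ 1 / 2 → ∀ K, ∃ L : ℂ,
      HasSum (fun c : PrimeCycle α => -Complex.log (1 - (wK K c : ℂ) * v ^ c.length)) L ∧
      Complex.exp L * (1 - v • (Matrix.of fun i i' =>
        ((W (j K i) (j K i') : ℝ) : ℂ))).det = 1 := by
    intro v hv K
    have hcast : ∀ p, closedWeight (fun e e' => ((WK K e e' : ℝ) : ℂ)) p
        = ((closedWeight (WK K) p : ℝ) : ℂ) := fun p =>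
      closedWeight_hom (Complex.ofRealHom : ℝ →* ℂ) (WK K) p
    have hval : ∀ i i', WK K (j K i) (j K i') = W (j K i) (j K i') := fun i i' =>
      if_pos ⟨⟨i, rfl⟩, ⟨i', rfl⟩⟩
    obtain ⟨L, hL, hdet⟩ := exists_hasSum_wordTerm_of_injective
      (fun e e' => ((WK K e e' : ℝ) : ℂ)) (j K) (hj K) (B := B) (u := v)
      (fun e he e' => by simp only [WK]; rw [if_neg fun h => he h.1, Complex.ofReal_zero]) hB
      (fun i => by
        refine le_trans (le_of_eq ?_) (hrow K i)
        refine Finset.sum_congr rfl fun i' _ => ?_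
        rw [hval, Complex.norm_real, Real.norm_of_nonneg (hW0 _ _)])
      (by linarith)
    refine ⟨L, ?_, by simpa only [hval] using hdet⟩
    have := hasSum_neg_log_of_hasSum_wordTerm (α := α) (u := v) (fun e e' h => hWR e e' fun h0 => h
      (by simp only [WK, h0, ite_self, Complex.ofReal_zero])) (fun c => ?_) hL
    · simpa only [hcast] using this
    · rw [hcast, hnorm _ _ _ (hwK0 K c)]
      calc wK K c * ‖v‖ ^ c.length ≤ w c * ‖v‖ ^ c.length :=
            mul_le_mul_of_nonneg_right (hwK_le K c) (by positivity)
        _ ≤ 1 / 2 := hsmall _ (norm_nonneg _) hv c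
        _ < 1 := by norm_num
  set r : ℝ := ‖u‖ with hr
  have hr0 : 0 ≤ r := norm_nonneg u
  have hrn : ‖(r : ℂ)‖ = r := by rw [Complex.norm_real, Real.norm_of_nonneg hr0]
  -- at the positive real point `r` the sums of the `w c * r ^ c.length` are bounded by the
  -- truncated Euler products, which converge to `(P r)⁻¹`
  have hsummable : Summable fun c => w c * r ^ c.length := by
    refine summable_of_sum_le (c := ‖P r‖⁻¹) (fun c => mul_nonneg (hw0 c) (by positivity))
      fun S => ?_
    refine (by linarith [Real.add_one_le_exp (∑ c ∈ S, w c * r ^ c.length)] :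
      ∑ c ∈ S, w c * r ^ c.length ≤ Real.exp (∑ c ∈ S, w c * r ^ c.length)).trans ?_
    refine ge_of_tendsto ((hP r (by rw [hrn]; exact huε)).norm.inv₀
      (norm_ne_zero_iff.2 (hP0 r (by rw [hrn]; exact huε)))) ?_
    have hev : ∀ᶠ K in atTop, ∀ c ∈ S, wK K c = w c :=
      (Finset.eventually_all S).2 fun c _ => hwK_ev c
    filter_upwards [hev] with K hK
    obtain ⟨L, hL, hdet⟩ := hfin r (by rw [hrn]; exact huB) K
    have hexp : ‖(1 - (r : ℂ) • (Matrix.of fun i i' =>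
        ((W (j K i) (j K i') : ℝ) : ℂ))).det‖⁻¹ = Real.exp L.re := by
      rw [← Complex.norm_exp, eq_comm]
      refine eq_inv_of_mul_eq_one_left ?_
      rw [← norm_mul, hdet, norm_one]
    rw [hexp, Real.exp_le_exp]
    have hre : ∀ c : PrimeCycle α, (-Complex.log (1 - (wK K c : ℂ) * (r : ℂ) ^ c.length)).re
        = -Real.log (1 - wK K c * r ^ c.length) := by
      intro c
      rw [Complex.neg_re, ← Complex.ofReal_pow, ← Complex.ofReal_mul, ← Complex.ofReal_one,
        ← Complex.ofReal_sub, Complex.log_ofReal_re]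
    have hlog : ∀ c : PrimeCycle α, wK K c * r ^ c.length
        ≤ -Real.log (1 - wK K c * r ^ c.length) := by
      intro c
      have h1 : wK K c * r ^ c.length ≤ w c * r ^ c.length :=
        mul_le_mul_of_nonneg_right (hwK_le K c) (by positivity)
      have h2 := hsmall r hr0 huB c
      have := Real.log_le_sub_one_of_pos (show 0 < 1 - wK K c * r ^ c.length by linarith)
      linarith
    have hLre := Complex.hasSum_re hL
    simp only [hre] at hLre
    calc ∑ c ∈ S, w c * r ^ c.length = ∑ c ∈ S, wK K c * r ^ c.length :=
          Finset.sum_congr rfl fun c hc => by rw [hK c hc]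
      _ ≤ ∑ c ∈ S, -Real.log (1 - wK K c * r ^ c.length) := Finset.sum_le_sum fun c _ => hlog c
      _ ≤ L.re := sum_le_hasSum S (fun c _ => (mul_nonneg (hwK0 K c) (by positivity)).trans
          (hlog c)) hLre
  have hfac : ∀ c : PrimeCycle α, ‖(w c : ℂ) * u ^ c.length‖ ≤ 1 / 2 := fun c => by
    rw [hnorm _ _ _ (hw0 c)]
    exact hsmall r hr0 huB c
  refine ⟨hfac, ?_⟩
  -- a common bound for the logarithms of all truncations, for the dominated convergence theorem
  have hlogb : ∀ (x : ℝ) (c : PrimeCycle α), 0 ≤ x → x ≤ w c →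
      ‖-Complex.log (1 - (x : ℂ) * u ^ c.length)‖ ≤ 3 / 2 * (w c * r ^ c.length) := by
    intro x c hx hxw
    have h1 : x * r ^ c.length ≤ w c * r ^ c.length :=
      mul_le_mul_of_nonneg_right hxw (by positivity)
    have h2 := Complex.norm_log_one_add_half_le_self (z := -((x : ℂ) * u ^ c.length))
      (by rw [norm_neg, hnorm _ _ _ hx]; exact h1.trans (hsmall r hr0 huB c))
    rw [norm_neg, hnorm _ _ _ hx, ← sub_eq_add_neg] at h2
    rw [norm_neg]
    linarith
  have hsumm : Summable fun c : PrimeCycle α => -Complex.log (1 - (w c : ℂ) * u ^ c.length) :=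
    Summable.of_norm_bounded (hsummable.mul_left (3 / 2)) fun c => hlogb _ c (hw0 c) le_rfl
  choose L hL hdet using hfin u huB
  have hlim : Tendsto L atTop (𝓝 (∑' c : PrimeCycle α,
      -Complex.log (1 - (w c : ℂ) * u ^ c.length))) := by
    have : L = fun K => ∑' c : PrimeCycle α, -Complex.log (1 - (wK K c : ℂ) * u ^ c.length) :=
      funext fun K => (hL K).tsum_eq.symm
    rw [this]
    refine tendsto_tsum_of_dominated_convergence (hsummable.mul_left (3 / 2)) (fun c => ?_)
      (Eventually.of_forall fun K c => hlogb _ c (hwK0 K c) (hwK_le K c))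
    exact tendsto_const_nhds.congr' ((hwK_ev c).mono fun K h => by simp only [h])
  have hexp : Complex.exp (∑' c : PrimeCycle α, -Complex.log (1 - (w c : ℂ) * u ^ c.length))
      = (P u)⁻¹ := by
    refine tendsto_nhds_unique ((Complex.continuous_exp.tendsto _).comp hlim) ?_
    refine ((hP u huε).inv₀ (hP0 u huε)).congr fun K => ?_
    exact (eq_inv_of_mul_eq_one_left (hdet K)).symm
  rw [← hexp]
  refine hsumm.hasSum.cexp.congr_fun fun c => ?_
  have hne : 1 - (w c : ℂ) * u ^ c.length ≠ 0 := by
    intro h0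
    have h1 := hfac c
    rw [← sub_eq_zero.1 h0, norm_one] at h1
    norm_num at h1
  rw [Function.comp_apply, Complex.exp_neg, Complex.exp_log hne]

end Limit

/-! ### Functions that are rational near the origin -/

section Rational

open Filter Topology Polynomial

/-- A function that agrees near the origin with a rational function without pole there. -/
def IsRationalNearZero (f : ℂ → ℂ) : Prop :=
  ∃ p q : ℂ[X], q.eval 0 ≠ 0 ∧ ∀ᶠ u in 𝓝 (0 : ℂ), f u * q.eval u = p.eval u

namespace IsRationalNearZero

theorem eval (p : ℂ[X]) : IsRationalNearZero fun u => p.eval u :=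
  ⟨p, 1, by simp, by simp⟩

theorem const (a : ℂ) : IsRationalNearZero fun _ => a := by simpa using eval (C a)

theorem id : IsRationalNearZero fun u => u := by simpa using eval X

theorem add {f g : ℂ → ℂ} (hf : IsRationalNearZero f) (hg : IsRationalNearZero g) :
    IsRationalNearZero fun u => f u + g u := by
  obtain ⟨p, q, hq, h⟩ := hf
  obtain ⟨p', q', hq', h'⟩ := hg
  refine ⟨p * q' + p' * q, q * q', by simp [hq, hq'], ?_⟩
  filter_upwards [h, h'] with u h1 h2
  simp only [eval_add, eval_mul, ← h1, ← h2]
  ring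

theorem mul {f g : ℂ → ℂ} (hf : IsRationalNearZero f) (hg : IsRationalNearZero g) :
    IsRationalNearZero fun u => f u * g u := by
  obtain ⟨p, q, hq, h⟩ := hf
  obtain ⟨p', q', hq', h'⟩ := hg
  refine ⟨p * p', q * q', by simp [hq, hq'], ?_⟩
  filter_upwards [h, h'] with u h1 h2
  simp only [eval_mul, ← h1, ← h2]
  ring

theorem sum {ι : Type*} (s : Finset ι) {f : ι → ℂ → ℂ} (hf : ∀ i, IsRationalNearZero (f i)) :
    IsRationalNearZero fun u => ∑ i ∈ s, f i u := by
  classical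
  induction s using Finset.induction_on with
  | empty => simpa using const 0
  | insert i s hi ih => simpa [Finset.sum_insert hi] using (hf i).add ih

theorem prod {ι : Type*} (s : Finset ι) {f : ι → ℂ → ℂ} (hf : ∀ i, IsRationalNearZero (f i)) :
    IsRationalNearZero fun u => ∏ i ∈ s, f i u := by
  classical
  induction s using Finset.induction_on with
  | empty => simpa using const 1
  | insert i s hi ih => simpa [Finset.prod_insert hi] using (hf i).mul ih

theorem det {n : Type*} [Fintype n] [DecidableEq n] {M : ℂ → Matrix n n ℂ}
    (hM : ∀ i j, IsRationalNearZero fun u => M u i j) : IsRationalNearZero fun u => (M u).det := by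
  simp only [Matrix.det_apply']
  exact sum _ fun σ => (const _).mul (prod _ fun i => hM _ _)

end IsRationalNearZero

theorem exists_bound_of_periodic {c : ℕ → ℂ} {k : ℕ} (hk : 0 < k) (hc : ∀ n, c (n + k) = c n) :
    ∃ B : ℝ, ∀ n, ‖c n‖ ≤ B := by
  refine ⟨∑ m ∈ Finset.range k, ‖c m‖, fun n => ?_⟩
  have : c (n % k) = c n := Function.Periodic.map_mod_nat hc n
  rw [← this]
  exact Finset.single_le_sum (f := fun m => ‖c m‖) (fun _ _ => norm_nonneg _)
    (Finset.mem_range.2 (Nat.mod_lt n hk))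

/-- For periodic weights the generating function of all excursions into a cusp satisfies
`G = (a polynomial) + Q u ^ (2 k) G`, hence is rational. -/
theorem exists_tendsto_excursion {c d : ℕ → ℂ} {k : ℕ} (hk : 0 < k) (hc : ∀ n, c (n + k) = c n)
    (hd : ∀ n, d (n + k) = d n) :
    ∃ G : ℂ → ℂ, IsRationalNearZero G ∧ ∃ ε : ℝ, 0 < ε ∧ ∀ u : ℂ, ‖u‖ < ε →
      Tendsto (fun K => excursion c d K u) atTop (𝓝 (G u)) := by
  obtain ⟨B₁, hB₁⟩ := exists_bound_of_periodic hk hc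
  obtain ⟨B₂, hB₂⟩ := exists_bound_of_periodic hk hd
  set B := max 1 (max B₁ B₂) with hB
  have hB1 : 1 ≤ B := le_max_left _ _
  have hBc : ∀ n, ‖c n‖ ≤ B := fun n =>
    (hB₁ n).trans ((le_max_left _ _).trans (le_max_right _ _))
  have hBd : ∀ n, ‖d n‖ ≤ B := fun n =>
    (hB₂ n).trans ((le_max_right _ _).trans (le_max_right _ _))
  set t : ℕ → ℂ → ℂ := fun m u => u ^ (2 * m + 2) * d m * ∏ j ∈ Finset.range (m + 1), c j with ht
  have hsum : ∀ u : ℂ, ‖u‖ < 1 / B → Summable fun m => t m u := by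
    intro u hu
    have hu1 : ‖u‖ * B < 1 := by rwa [lt_div_iff₀ (by linarith)] at hu
    have hu2 : ‖u‖ ≤ 1 := by nlinarith [norm_nonneg u]
    have hlt : ‖u‖ ^ 2 * B < 1 := by nlinarith [norm_nonneg u]
    refine Summable.of_norm_bounded
      ((summable_geometric_of_lt_one (by positivity) hlt).mul_left (‖u‖ ^ 2 * B * B)) fun m => ?_
    have hprod : ‖∏ j ∈ Finset.range (m + 1), c j‖ ≤ B ^ (m + 1) := by
      rw [norm_prod]
      exact (Finset.prod_le_prod (fun _ _ => norm_nonneg _) fun j _ => hBc j).trans (by simp)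
    calc ‖t m u‖ = ‖u‖ ^ (2 * m + 2) * ‖d m‖ * ‖∏ j ∈ Finset.range (m + 1), c j‖ := by
          simp only [ht, norm_mul, norm_pow]
      _ ≤ ‖u‖ ^ (2 * m + 2) * B * B ^ (m + 1) := by
          gcongr
          exact hBd m
      _ = ‖u‖ ^ 2 * B * B * (‖u‖ ^ 2 * B) ^ m := by ring
  -- a period multiplies the terms by a fixed monomial
  have hshift : ∀ m u, t (m + k) u = (∏ j ∈ Finset.range k, c j) * u ^ (2 * k) * t m u := by
    intro m u
    have h1 : ∏ j ∈ Finset.range (m + k + 1), c j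
        = (∏ j ∈ Finset.range k, c j) * ∏ j ∈ Finset.range (m + 1), c j := by
      rw [show m + k + 1 = k + (m + 1) by ring, Finset.prod_range_add]
      congr 1
      exact Finset.prod_congr rfl fun j _ => by rw [add_comm, hc]
    simp only [ht, h1, hd]
    ring
  refine ⟨fun u => ∑' m, t m u, ?_, 1 / B, by positivity, fun u hu => ?_⟩
  · refine ⟨∑ m ∈ Finset.range k, X ^ (2 * m + 2) * C (d m) *
        C (∏ j ∈ Finset.range (m + 1), c j),
      1 - C (∏ j ∈ Finset.range k, c j) * X ^ (2 * k), by simp [hk.ne'], ?_⟩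
    filter_upwards [Metric.ball_mem_nhds (0 : ℂ) (show 0 < 1 / B by positivity)] with u hu
    rw [mem_ball_zero_iff] at hu
    have h := (hsum u hu).sum_add_tsum_nat_add k
    simp only [hshift, tsum_mul_left] at h
    simp only [eval_finsetSum, eval_sub, eval_mul, eval_pow, eval_X, eval_C, eval_one]
    linear_combination (exp := 1) -h
  · exact (hsum u hu).hasSum.tendsto_sum_nat

end Rational

/-! ### Rays and ends of a tree -/

section Rays

variable {V : Type*} {Y : SimpleGraph V}

theorem dartMap_fst (g : Y ≃g Y) (e : Y.Dart) : (dartMap g e).fst = g e.fst := rfl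

theorem dart_ext {e f : Y.Dart} (h1 : e.fst = f.fst) (h2 : e.snd = f.snd) : e = f :=
  SimpleGraph.Dart.ext _ _ (Prod.ext h1 h2)

theorem Ray.toEnd_eq_of_shift {r s : Ray Y} (a b : ℕ)
    (h : ∀ n, r.vertex (n + a) = s.vertex (n + b)) : r.toEnd = s.toEnd :=
  Quotient.sound ⟨a, b, h⟩

theorem Ray.exists_shift_of_toEnd_eq {r s : Ray Y} (h : r.toEnd = s.toEnd) :
    ∃ a b : ℕ, ∀ n, r.vertex (n + a) = s.vertex (n + b) :=
  Quotient.exact h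

/-- Every vertex is the origin of a ray in a given end. -/
theorem Ray.exists_from (hY : Y.Connected) (r : Ray Y) (x : V) :
    ∃ s : Ray Y, s.vertex 0 = x ∧ s.toEnd = r.toEnd := by
  -- moving the origin by one edge either prolongs the ray or drops its first vertex
  have hstep : ∀ {u v : V}, Y.Walk u v → (∃ s : Ray Y, s.vertex 0 = v ∧ s.toEnd = r.toEnd) →
      ∃ s : Ray Y, s.vertex 0 = u ∧ s.toEnd = r.toEnd := by
    intro u v p hv
    induction p with
    | nil => exact hv
    | @cons u w v h p ih =>
      obtain ⟨s, hs0, hs⟩ := ih hv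
      by_cases h1 : s.vertex 1 = u
      · refine ⟨⟨fun n => s.vertex (n + 1), fun n => s.adj _, fun n => s.reduced _⟩, h1, ?_⟩
        rw [← hs]
        exact Ray.toEnd_eq_of_shift 0 1 fun n => rfl
      · refine ⟨⟨fun n => Nat.casesOn n u s.vertex, ?_, ?_⟩, rfl, ?_⟩
        · rintro (_ | n)
          · change Y.Adj u (s.vertex 0)
            rw [hs0]
            exact h
          · exact s.adj n
        · rintro (_ | n)
          · exact h1
          · exact s.reduced n
        · rw [← hs]
          exact Ray.toEnd_eq_of_shift 1 0 fun n => rfl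
  obtain ⟨p⟩ := hY.preconnected x (r.vertex 0)
  exact hstep p ⟨r, rfl, rfl⟩

/-- The initial segment of length `n` of a ray. -/
def Ray.walk (r : Ray Y) : (n : ℕ) → Y.Walk (r.vertex 0) (r.vertex n)
  | 0 => .nil
  | n + 1 => (r.walk n).concat (r.adj n)

theorem Ray.edges_walk (r : Ray Y) (n : ℕ) :
    (r.walk n).edges = (List.range n).map fun i => s(r.vertex i, r.vertex (i + 1)) := by
  induction n with
  | zero => rfl
  | succ n ih => simp [Ray.walk, SimpleGraph.Walk.edges_concat, ih, List.range_succ]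

theorem Ray.support_walk (r : Ray Y) (n : ℕ) :
    (r.walk n).support = (List.range (n + 1)).map r.vertex := by
  induction n with
  | zero => rfl
  | succ n ih => simp [Ray.walk, SimpleGraph.Walk.support_concat, ih, List.range_succ]

theorem Ray.isPath_walk (hY : Y.IsAcyclic) (r : Ray Y) (n : ℕ) : (r.walk n).IsPath := by
  rw [hY.isPath_iff_isChain, Ray.edges_walk, List.isChain_iff_getElem]
  intro i hi
  simp only [List.getElem_map, List.getElem_range, ne_eq, Sym2.eq_iff, not_or, not_and]
  exact ⟨fun h => absurd h (r.adj i).ne, fun h => absurd h.symm (r.reduced i)⟩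

/-- In a tree there is only one ray in a given end with a given origin. -/
theorem Ray.vertex_eq_of_toEnd_eq (hY : Y.IsAcyclic) {r s : Ray Y} (h : r.toEnd = s.toEnd)
    (h0 : r.vertex 0 = s.vertex 0) (i : ℕ) : r.vertex i = s.vertex i := by
  obtain ⟨a, b, hab⟩ := Ray.exists_shift_of_toEnd_eq h
  have hsupp : ∀ {u v u' v' : V} (p : Y.Walk u v) (q : Y.Walk u' v'), u = u' → v = v' →
      p.IsPath → q.IsPath → p.support = q.support := by
    rintro u v _ _ p q rfl rfl hp hq
    have := (hY.subsingleton_path _ _).elim ⟨p, hp⟩ ⟨q, hq⟩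
    rw [Subtype.mk.injEq] at this
    rw [this]
  have h1 := hsupp (r.walk (i + a)) (s.walk (i + b)) h0 (hab i) (r.isPath_walk hY _)
    (s.isPath_walk hY _)
  rw [Ray.support_walk, Ray.support_walk] at h1
  have h2 := congrArg (fun l => l[i]?) h1
  simpa [List.getElem?_range, show i < i + a + 1 by omega, show i < i + b + 1 by omega] using h2

/-- The oriented edge `f` is the first edge of a reduced path of length `k`. -/
def Extends (f : Y.Dart) (k : ℕ) : Prop :=
  ∃ y : ℕ → V, y 0 = f.fst ∧ y 1 = f.snd ∧ (∀ i < k, Y.Adj (y i) (y (i + 1))) ∧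
    ∀ i, i + 1 < k → y (i + 2) ≠ y i

theorem Extends.mono {f : Y.Dart} {k l : ℕ} (hkl : k ≤ l) (h : Extends f l) : Extends f k := by
  obtain ⟨y, h0, h1, h2, h3⟩ := h
  exact ⟨y, h0, h1, fun i hi => h2 i (by omega), fun i hi => h3 i (by omega)⟩

theorem Extends.map (g : Y ≃g Y) {f : Y.Dart} {k : ℕ} (h : Extends f k) :
    Extends (dartMap g f) k := by
  obtain ⟨y, h0, h1, h2, h3⟩ := h
  exact ⟨fun i => g (y i), congrArg g h0, congrArg g h1, fun i hi => g.map_adj_iff.2 (h2 i hi),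
    fun i hi h => h3 i hi (g.injective h)⟩

theorem extends_map_iff (g : Y ≃g Y) {f : Y.Dart} {k : ℕ} :
    Extends (dartMap g f) k ↔ Extends f k :=
  ⟨fun h => by simpa only [dartMap_inv_self] using h.map g⁻¹, Extends.map g⟩

theorem Ray.extends_edge (r : Ray Y) (n k : ℕ) : Extends (r.edge n) k :=
  ⟨fun i => r.vertex (n + i), rfl, rfl, fun _ _ => r.adj _, fun _ _ => r.reduced _⟩

theorem Ray.extends_edge_symm (r : Ray Y) (n : ℕ) : Extends (r.edge n).symm (n + 1) := by
  refine ⟨fun i => r.vertex (n + 1 - i), rfl, rfl, fun i hi => ?_, fun i hi => ?_⟩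
  · have := r.adj (n - i)
    rw [show n - i + 1 = n + 1 - i by omega, show n - i = n + 1 - (i + 1) by omega] at this
    exact this.symm
  · have := r.reduced (n + 1 - (i + 2))
    rw [show n + 1 - (i + 2) + 2 = n + 1 - i by omega] at this
    exact this.symm

/-- In a uniform tree the branches of finite depth have bounded depth. -/
theorem IsUniformTree.exists_extends_bound (hY : IsUniformTree Y) :
    ∃ D : ℕ, ∀ f : Y.Dart, Extends f D → ∀ k, Extends f k := by
  classical
  have hfin := hY.finite_edges
  have hch : ∀ x : QEdge (MonoidHom.id (Y ≃g Y)), ∃ D : ℕ, ∀ f : Y.Dart, projE _ f = x →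
      Extends f D → ∀ k, Extends f k := by
    intro x
    induction x using Quotient.inductionOn with
    | h f₀ =>
      by_cases h : ∀ k, Extends f₀ k
      · refine ⟨0, fun f hf _ k => ?_⟩
        obtain ⟨g, hg⟩ := Quotient.exact hf.symm
        rw [← hg]
        exact (h k).map _
      · push Not at h
        obtain ⟨D, hD⟩ := h
        refine ⟨D, fun f hf hf' => ?_⟩
        obtain ⟨g, hg⟩ := Quotient.exact hf
        rw [← (extends_map_iff (MonoidHom.id (Y ≃g Y) g)), hg] at hf'
        exact absurd hf' hD
  choose D hD using hch
  have := Fintype.ofFinite (QEdge (MonoidHom.id (Y ≃g Y)))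
  exact ⟨Finset.univ.sup D, fun f hf => hD (projE _ f) f rfl
    (hf.mono (Finset.le_sup (Finset.mem_univ _)))⟩

/-- A branch leaving the ray `r` at its `n`-th vertex is continued, in the opposite direction, by
the ray. -/
theorem Ray.exists_of_extends (r : Ray Y) {n l : ℕ} {f : Y.Dart} (hl : 0 < l)
    (hf : f.fst = r.vertex n) (hne : f.snd ≠ r.vertex (n + 1)) (hext : Extends f l) :
    ∃ z : Ray Y, z.vertex (l - 1) = f.snd ∧ ∀ i, z.vertex (l + i) = r.vertex (n + i) := by
  obtain ⟨y, h0, h1, h2, h3⟩ := hext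
  have hz1 : ∀ j, j ≤ l → (if j ≤ l then y (l - j) else r.vertex (n + (j - l))) = y (l - j) :=
    fun j hj => if_pos hj
  have hz2 : ∀ j, l ≤ j → (if j ≤ l then y (l - j) else r.vertex (n + (j - l)))
      = r.vertex (n + (j - l)) := by
    intro j hj
    split_ifs with h
    · obtain rfl : j = l := le_antisymm h hj
      simp [h0, hf]
    · rfl
  refine ⟨⟨fun j => if j ≤ l then y (l - j) else r.vertex (n + (j - l)), fun j => ?_,
    fun j => ?_⟩, ?_, fun i => ?_⟩
  · rcases Nat.lt_or_ge j l with h | h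
    · rw [hz1 j h.le, hz1 (j + 1) h]
      have := h2 (l - (j + 1)) (by omega)
      rw [show l - (j + 1) + 1 = l - j by omega] at this
      exact this.symm
    · rw [hz2 j h, hz2 (j + 1) (by omega), show n + (j + 1 - l) = n + (j - l) + 1 by omega]
      exact r.adj _
  · rcases Nat.lt_or_ge (j + 1) l with h | h
    · rw [hz1 (j + 2) h, hz1 j (by omega)]
      have := h3 (l - (j + 2)) (by omega)
      rw [show l - (j + 2) + 2 = l - j by omega] at this
      exact this.symm
    · rcases Nat.lt_or_ge j l with h' | h'
      · rw [hz1 j h'.le, hz2 (j + 2) (by omega), show l - j = 1 by omega, h1,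
          show n + (j + 2 - l) = n + 1 by omega]
        exact hne.symm
      · rw [hz2 (j + 2) (by omega), hz2 j h', show n + (j + 2 - l) = n + (j - l) + 2 by omega]
        exact r.reduced _
  · change (if l - 1 ≤ l then y (l - (l - 1)) else _) = _
    rw [if_pos (by omega), show l - (l - 1) = 1 by omega, h1]
  · change (if l + i ≤ l then y (l - (l + i)) else r.vertex (n + (l + i - l))) = _
    rw [hz2 (l + i) (by omega), show l + i - l = i by omega]

variable {Γ : Type*} [Group Γ]

/-- Far out in a cusp, the elements of `Γ` that fix the ray from some vertex on act transitively on
those edges leading away from the cusp that begin reduced paths of every length. -/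
theorem IsCusp.exists_transitive (hY : Y.IsTree) (α : Γ →* (Y ≃g Y)) (r : Ray Y)
    (hc : IsCusp α r.toEnd) :
    ∃ N, ∀ n, N ≤ n → ∀ f : Y.Dart, f.fst = r.vertex (n + 1) → f.snd ≠ r.vertex (n + 2) →
      (∀ k, Extends f k) → (∀ k, Extends (r.edge n).symm k) →
      ∃ g : Γ, (∀ m, n + 1 ≤ m → α g (r.vertex m) = r.vertex m) ∧
        dartMap (α g) (r.edge n).symm = f := by
  obtain ⟨-, H, ⟨x, rfl⟩, htrans⟩ := hc
  obtain ⟨s, hs0, hs⟩ := Ray.exists_from hY.connected r x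
  obtain ⟨a, b, hab⟩ := Ray.exists_shift_of_toEnd_eq hs.symm
  refine ⟨a, fun n hn f hf hne hext hext' => ?_⟩
  -- the ray `s` from the horocycle of transitivity meets `r` in `r.vertex (n + 1)` after `l` steps;
  -- replacing its first `l` steps by a path through `f` gives a ray from the same horocycle
  set l := n + 1 - a + b with hl
  have hsl : s.vertex l = r.vertex (n + 1) := by
    rw [hl, ← hab, show n + 1 - a + a = n + 1 by omega]
  have hl0 : 0 < l := by omega
  have key : ∀ f : Y.Dart, f.fst = r.vertex (n + 1) → f.snd ≠ r.vertex (n + 2) →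
      (∀ k, Extends f k) → ∃ z : Ray Y, z.vertex (l - 1) = f.snd ∧
        (∀ i, z.vertex (l + i) = r.vertex (n + 1 + i)) ∧ z.toEnd = r.toEnd ∧
        SameHorocycle r.toEnd x (z.vertex 0) := by
    intro f hf hne hext
    obtain ⟨z, hz1, hz2⟩ := r.exists_of_extends hl0 hf hne (hext l)
    have hz : z.toEnd = r.toEnd := Ray.toEnd_eq_of_shift l (n + 1) fun i => by
      rw [add_comm i l, hz2, add_comm]
    exact ⟨z, hz1, hz2, hz, s, z, hs, hz, hs0, rfl, l, by rw [hsl, ← add_zero l, hz2, add_zero]⟩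
  obtain ⟨z, hz1, hz2, hz, hzH⟩ := key f hf hne hext
  obtain ⟨z', hz1', hz2', hz', hzH'⟩ := key (r.edge n).symm rfl (r.reduced n).symm hext'
  obtain ⟨g, ⟨hg, -⟩, hgz⟩ := htrans _ hzH' _ hzH
  have hend : (z'.map (α g)).toEnd = z.toEnd := by
    rw [hz]
    have hg' : Boundary.map (α g) r.toEnd = r.toEnd := hg
    rw [← hz'] at hg'
    exact hg'.trans hz'
  have heq : ∀ i, α g (z'.vertex i) = z.vertex i :=
    Ray.vertex_eq_of_toEnd_eq hY.isAcyclic hend hgz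
  have hfix : ∀ m, n + 1 ≤ m → α g (r.vertex m) = r.vertex m := by
    intro m hm
    have := heq (l + (m - (n + 1)))
    rwa [hz2, hz2', show n + 1 + (m - (n + 1)) = m by omega] at this
  refine ⟨g, hfix, dart_ext ?_ ?_⟩
  · rw [hf]
    exact hfix (n + 1) le_rfl
  · have := heq (l - 1)
    rwa [hz1, hz1'] at this

end Rays

/-! ### The image of a cusp in the quotient graph -/

section Cusps

variable {V : Type*} {Y : SimpleGraph V} {Γ : Type*} [Group Γ] {α : Γ →* (Y ≃g Y)}

theorem QEdge.inv_inv (e : QEdge α) : e.inv.inv = e :=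
  Quotient.inductionOn e fun f => congrArg (projE α) f.symm_symm

theorem QEdge.origin_inv (e : QEdge α) : e.inv.origin = e.terminus :=
  Quotient.inductionOn e fun _ => rfl

theorem QEdge.terminus_inv (e : QEdge α) : e.inv.terminus = e.origin :=
  Quotient.inductionOn e fun _ => rfl

theorem projE_eq_iff {e f : Y.Dart} : projE α e = projE α f ↔ ∃ g : Γ, dartMap (α g) e = f :=
  ⟨fun h => Quotient.exact h, fun h => Quotient.sound h⟩

/-- Every edge of `X` issuing from the image of `x` lifts to an edge of `Y` issuing from `x`. -/
theorem QEdge.exists_lift {e : QEdge α} {x : V} (h : e.origin = projV α x) :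
    ∃ f : Y.Dart, f.fst = x ∧ projE α f = e := by
  induction e using Quotient.inductionOn with
  | h f =>
    obtain ⟨g, hg⟩ := Quotient.exact h
    exact ⟨dartMap (α g) f, hg, (projE_eq_iff.2 ⟨g, rfl⟩).symm⟩

/-- A path in `X` that is folded back at two places stays in the finite segment between them,
provided that its edges and their inverses are the only edges at its vertices. -/
theorem finite_range_of_folds {a : ℕ → QEdge α} (hnext : ∀ n, (a n).terminus = (a (n + 1)).origin)
    {n₁ n₂ : ℕ} (hlt : n₁ < n₂)
    (hsucc : ∀ n, n₁ ≤ n → ∀ e : QEdge α, e.origin = (a n).terminus → e = a (n + 1) ∨ e = (a n).inv)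
    (h₁ : a (n₁ + 1) = (a n₁).inv) (h₂ : a (n₂ + 1) = (a n₂).inv) : (Set.range a).Finite := by
  -- a set of edges that no path can leave
  set S : Set (QEdge α) := {e | ∃ j, n₁ < j ∧ j ≤ n₂ ∧ (e = a j ∨ e = (a j).inv)} with hS
  have hSfin : S.Finite := by
    refine (((Set.finite_Iic n₂).image a).union
      ((Set.finite_Iic n₂).image fun j => (a j).inv)).subset ?_
    rintro e ⟨j, -, hj, rfl | rfl⟩
    · exact Or.inl ⟨j, hj, rfl⟩
    · exact Or.inr ⟨j, hj, rfl⟩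
  have hclosed : ∀ e ∈ S, ∀ e' : QEdge α, e'.origin = e.terminus → e' ∈ S := by
    rintro e ⟨j, hj1, hj2, rfl | rfl⟩ e' he'
    · rcases hsucc j hj1.le e' he' with h | h
      · rcases hj2.lt_or_eq with hlt' | rfl
        · exact ⟨j + 1, by omega, hlt', Or.inl h⟩
        · exact ⟨j, hj1, le_rfl, Or.inr (h.trans h₂)⟩
      · exact ⟨j, hj1, hj2, Or.inr h⟩
    · obtain ⟨i, rfl⟩ : ∃ i, j = i + 1 := ⟨j - 1, by omega⟩
      rw [QEdge.terminus_inv, ← hnext] at he'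
      rcases hsucc i (by omega) e' he' with h | h
      · exact ⟨i + 1, hj1, hj2, Or.inl h⟩
      · rcases (show n₁ ≤ i by omega).lt_or_eq with hlt' | rfl
        · exact ⟨i, hlt', by omega, Or.inr h⟩
        · exact ⟨n₁ + 1, hj1, hj2, Or.inl (h.trans h₁.symm)⟩
  have hmem : ∀ k, a (n₁ + 1 + k) ∈ S := by
    intro k
    induction k with
    | zero => exact ⟨n₁ + 1, by omega, hlt, Or.inl rfl⟩
    | succ k ih => exact hclosed _ ih _ (hnext _).symm
  refine (hSfin.union ((Set.finite_Iic n₁).image a)).subset ?_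
  rintro _ ⟨n, rfl⟩
  rcases Nat.lt_or_ge n₁ n with h | h
  · left
    have := hmem (n - (n₁ + 1))
    rwa [show n₁ + 1 + (n - (n₁ + 1)) = n by omega] at this
  · exact Or.inr ⟨n, h, rfl⟩

/-- The stabilizer of a vertex. -/
def vertexStab (α : Γ →* (Y ≃g Y)) (x : V) : Set Γ := {g | α g x = x}

theorem finite_vertexStab (hY : ∀ x : V, (Y.neighborSet x).Finite)
    (hα : ∀ e : Y.Dart, (edgeStab α e).Finite) (e : Y.Dart) : (vertexStab α e.fst).Finite := by
  refine Set.Finite.of_finite_fibers (fun g => α g e.snd) ?_ ?_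
  · refine (hY e.fst).subset ?_
    rintro _ ⟨g, hg, rfl⟩
    have hg' : α g e.fst = e.fst := hg
    have := (α g).map_adj_iff.2 e.adj
    rwa [hg'] at this
  · rintro _ ⟨g₀, hg₀, rfl⟩
    refine ((hα e).image (fun g => g₀ * g)).subset ?_
    rintro g ⟨hg, hg'⟩
    have h1 : α g e.fst = e.fst := hg
    have h2 : α g₀ e.fst = e.fst := hg₀
    have h3 : α g e.snd = α g₀ e.snd := hg'
    have heq : dartMap (α g) e = dartMap (α g₀) e := dart_ext (h1.trans h2.symm) h3
    refine ⟨g₀⁻¹ * g, ?_, by simp⟩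
    change dartMap (α (g₀⁻¹ * g)) e = e
    rw [map_mul, dartMap_mul, heq, map_inv, dartMap_inv_self]

theorem ncard_vertexStab_map (g : Γ) (x : V) :
    (vertexStab α (α g x)).ncard = (vertexStab α x).ncard := by
  have h : vertexStab α (α g x) = (MulAut.conj g) '' vertexStab α x := by
    have hcomp : ∀ (k l : Γ) (y : V), α (k * l) y = α k (α l y) := fun k l y => by
      rw [map_mul]; rfl
    have hinv : ∀ (k : Γ) (y : V), α k⁻¹ (α k y) = y := fun k y => by
      rw [← hcomp, inv_mul_cancel, map_one]; rfl
    ext k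
    constructor
    · intro hk
      have hk' : α k (α g x) = α g x := hk
      refine ⟨g⁻¹ * k * g, ?_, by simp [mul_assoc]⟩
      change α (g⁻¹ * k * g) x = x
      rw [hcomp, hcomp, hk', hinv]
    · rintro ⟨k, hk, rfl⟩
      have hk' : α k x = x := hk
      change α (g * k * g⁻¹) (α g x) = α g x
      rw [hcomp, hcomp, hinv, hk']
  rw [h, Set.ncard_image_of_injective _ (MulAut.conj g).injective]

/-- Only finitely many edges of the quotient by a tree lattice have stabilizers of bounded order. -/
theorem IsTreeLattice.finite_stabCard_le (hα : IsTreeLattice α) (b : ℕ) :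
    {e : QEdge α | e.stabCard ≤ b}.Finite := by
  have hpos : ∀ e : QEdge α, 0 < e.stabCard := fun e => Quotient.inductionOn e fun f =>
    (Set.ncard_pos (hα.finite_stab f)).2 ⟨1, by
      change dartMap (α 1) f = f
      rw [map_one]; rfl⟩
  have h := hα.summable.tendsto_cofinite_zero.eventually
    (gt_mem_nhds (show (0 : ℝ) < 1 / (b + 1) by positivity))
  rw [Filter.eventually_cofinite] at h
  refine h.subset fun e he => ?_
  have he' : (e.stabCard : ℝ) ≤ b := by exact_mod_cast (show e.stabCard ≤ b from he)
  have hp : (0 : ℝ) < e.stabCard := by exact_mod_cast hpos e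
  change ¬ ((1 : ℝ) / e.stabCard < 1 / (b + 1))
  rw [not_lt]
  exact one_div_le_one_div_of_le hp (by linarith)

/-- If the image of a cusp in `X` is infinite, then far out in the cusp all branches of `Y` are
infinite. Otherwise the vertices with a finite branch, which have stabilizers of bounded order,
occur arbitrarily far out, so the increasing stabilizers of the subrays become constant. Then a ray
with finite branches only is left, and its edges have stabilizers of bounded order. -/
theorem exists_forall_extends (hY : IsUniformTree Y) (hα : IsTreeLattice α)
    {EF : Set (QEdge α)} (hEF : EF.Finite) {R : Set (Ray Y)} (hR : R.Finite)
    (hcov : ∀ e : QEdge α, e ∈ EF ∨ ∃ r ∈ R, ∃ n,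
      e = projE α (r.edge n) ∨ e = projE α (r.edge n).symm)
    (r : Ray Y) (hc : IsCusp α r.toEnd)
    (hinf : (Set.range fun n => projE α (r.edge n)).Infinite) :
    ∃ N, ∀ n, N ≤ n → ∀ f : Y.Dart, f.fst = r.vertex n → ∀ k, Extends f k := by
  obtain ⟨D, hD⟩ := hY.exists_extends_bound
  by_contra! hcon
  -- the classes of the edges that begin only finitely long paths
  set dead : Set (QEdge α) := {x | ∃ f : Y.Dart, projE α f = x ∧ ¬ ∀ k, Extends f k} with hdead
  have hdeadfin : dead.Finite := by
    refine (hEF.union (hR.biUnion fun r' _ =>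
      (Set.finite_Iio D).image fun k => projE α (r'.edge k).symm)).subset ?_
    rintro x ⟨f, rfl, hf⟩
    rcases hcov (projE α f) with h | ⟨r', hr', n, h | h⟩
    · exact Or.inl h
    · obtain ⟨g, hg⟩ := projE_eq_iff.1 h
      refine absurd (fun k => ?_) hf
      rw [← extends_map_iff (α g), hg]
      exact r'.extends_edge n k
    · right
      refine Set.mem_biUnion hr' ⟨n, ?_, h.symm⟩
      obtain ⟨g, hg⟩ := projE_eq_iff.1 h
      by_contra hn
      refine hf (hD f ?_)
      rw [← extends_map_iff (α g), hg]
      exact (r'.extends_edge_symm n).mono (by simp only [Set.mem_Iio] at hn; omega)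
  obtain ⟨b, hb⟩ : ∃ b : ℕ, ∀ y : V, projV α y ∈ QEdge.origin '' dead →
      (vertexStab α y).ncard ≤ b := by
    have hcls : ∀ v : QVertex α, ∃ b : ℕ, ∀ y : V, projV α y = v → (vertexStab α y).ncard ≤ b := by
      intro v
      induction v using Quotient.inductionOn with
      | h x =>
        refine ⟨(vertexStab α x).ncard, fun y hy => ?_⟩
        obtain ⟨g, rfl⟩ := Quotient.exact hy.symm
        exact (ncard_vertexStab_map g x).le
    choose b hb using hcls
    refine ⟨(hdeadfin.image QEdge.origin).toFinset.sup b, fun y hy => (hb _ y rfl).trans ?_⟩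
    exact Finset.le_sup ((Set.Finite.mem_toFinset _).2 hy)
  -- the pointwise stabilizers of the subrays
  set A : ℕ → Set Γ := fun n => {g | ∀ m, n ≤ m → α g (r.vertex m) = r.vertex m} with hA
  have hAmono : ∀ {n m}, n ≤ m → A n ⊆ A m := fun hnm g hg k hk => hg k (hnm.trans hk)
  have hAfin : ∀ n, (A n).Finite := fun n => (hα.finite_stab (r.edge n)).subset fun g hg =>
    dart_ext (hg n le_rfl) (hg (n + 1) n.le_succ)
  have hAb : ∀ n, (A n).ncard ≤ b := by
    intro n
    obtain ⟨m, hnm, f, hf, hfd⟩ := hcon n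
    have hsub : A n ⊆ vertexStab α f.fst := fun g hg => by
      change α g f.fst = f.fst
      rw [hf]
      exact hg m hnm
    refine (Set.ncard_le_ncard hsub (finite_vertexStab hY.locallyFinite hα.finite_stab f)).trans
      (hb _ ⟨projE α f, ⟨f, rfl, ?_⟩, rfl⟩)
    push Not
    exact hfd
  obtain ⟨n₀, hn₀⟩ : ∃ n₀, ∀ n, n₀ ≤ n → A n = A n₀ := by
    have hbdd : BddAbove (Set.range fun n => (A n).ncard) := ⟨b, by rintro _ ⟨n, rfl⟩; exact hAb n⟩
    obtain ⟨n₀, h⟩ := Nat.sSup_mem (Set.range_nonempty _) hbdd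
    refine ⟨n₀, fun n hn => (Set.eq_of_subset_of_ncard_le (hAmono hn) ?_ (hAfin n)).symm⟩
    exact (le_csSup hbdd ⟨n, rfl⟩).trans h.ge
  obtain ⟨N₁, hN₁⟩ := hc.exists_transitive hY.isTree α r
  set N := max n₀ (max N₁ D) with hN
  -- once the stabilizers are constant, the only infinite branch leading away from the end is
  -- the ray
  have hback : ∀ n, N ≤ n → ∀ f : Y.Dart, f.fst = r.vertex (n + 1) → f.snd ≠ r.vertex (n + 2) →
      (∀ k, Extends f k) → f = (r.edge n).symm := by
    intro n hn f hf hne hext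
    obtain ⟨g, hg, rfl⟩ := hN₁ n (by omega) f hf hne hext
      (hD _ ((r.extends_edge_symm n).mono (by omega)))
    have hgA : g ∈ A n := by
      rw [hn₀ n (by omega), ← hn₀ (n + 1) (by omega)]
      exact hg
    exact dart_ext (hgA (n + 1) n.le_succ) (hgA n le_rfl)
  -- hence an element that fixes an edge of the ray fixes everything beyond it
  have hstab : ∀ n, N ≤ n → edgeStab α (r.edge n) ⊆ A n := by
    intro n hn g hg
    have h0 : α g (r.vertex n) = r.vertex n := congrArg (fun e : Y.Dart => e.fst) hg
    have h1 : α g (r.vertex (n + 1)) = r.vertex (n + 1) := congrArg (fun e : Y.Dart => e.snd) hg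
    have h : ∀ k, α g (r.vertex (n + k)) = r.vertex (n + k) ∧
        α g (r.vertex (n + k + 1)) = r.vertex (n + k + 1) := by
      intro k
      induction k with
      | zero => exact ⟨h0, h1⟩
      | succ k ih =>
        refine ⟨ih.2, ?_⟩
        by_contra hne
        have h2 := hback (n + k) (by omega) (dartMap (α g) (r.edge (n + k + 1))) ih.2 hne
          fun j => (r.extends_edge _ j).map _
        have h3 : α g (r.vertex (n + k + 2)) = r.vertex (n + k) :=
          congrArg (fun e : Y.Dart => e.snd) h2
        rw [← ih.1] at h3
        exact r.reduced _ ((α g).injective h3)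
    intro m hm
    have := (h (m - n)).1
    rwa [show n + (m - n) = m by omega] at this
  refine hinf (((hα.finite_stabCard_le b).union ((Set.finite_Iio N).image
    fun n => projE α (r.edge n))).subset ?_)
  rintro _ ⟨n, rfl⟩
  rcases Nat.lt_or_ge n N with h | h
  · exact Or.inr ⟨n, h, rfl⟩
  · exact Or.inl ((Set.ncard_le_ncard (hstab n h) (hAfin n)).trans (hAb n))

/-- A sequence of edges of `X` forming an infinite path that runs straight into a cusp: its edges
and their inverses are distinct, they are the only edges at its inner vertices, and the ascending
edges have weight one. -/
structure IsCuspPath (a : ℕ → QEdge α) : Prop where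
  injective : Function.Injective a
  ne_inv : ∀ m n, a m ≠ (a n).inv
  next : ∀ n, (a n).terminus = (a (n + 1)).origin
  eq_or_eq : ∀ n, ∀ e : QEdge α, e.origin = (a n).terminus → e = a (n + 1) ∨ e = (a n).inv
  weight_succ : ∀ n, (a (n + 1)).weight = 1

/-- If an edge of the path is the inverse of a later one, then the same holds one step further
inside, and halfway in between there is a fold or an inversion. -/
theorem ne_inv_of_no_fold {a : ℕ → QEdge α} (hnext : ∀ n, (a n).terminus = (a (n + 1)).origin)
    (hsucc : ∀ n, ∀ e : QEdge α, e.origin = (a n).terminus → e = a (n + 1) ∨ e = (a n).inv)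
    (hfold : ∀ n, a (n + 1) ≠ (a n).inv) (hself : ∀ n, a n ≠ (a n).inv) (m n : ℕ) :
    a m ≠ (a n).inv := by
  have hle : ∀ k m, a m ≠ (a (m + k)).inv := by
    intro k
    induction k using Nat.strong_induction_on with
    | _ k ih =>
      intro m h
      rcases k with _ | _ | k
      · exact hself m h
      · refine hfold m ?_
        rw [h, QEdge.inv_inv]
      · have h1 : (a (m + 1)).origin = (a (m + k + 1)).terminus := by
          rw [← hnext, h, QEdge.terminus_inv, hnext]
          rfl
        rcases hsucc _ _ h1 with h2 | h2
        · refine hfold m ?_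
          rw [h2, h, QEdge.inv_inv]
          rfl
        · exact ih k (by omega) (m + 1) (by rw [h2, show m + k + 1 = m + 1 + k by ring])
  intro h
  rcases Nat.le_total m n with hmn | hmn
  · obtain ⟨k, rfl⟩ := Nat.exists_eq_add_of_le hmn
    exact hle k m h
  · obtain ⟨k, rfl⟩ := Nat.exists_eq_add_of_le hmn
    refine hle k n ?_
    rw [h, QEdge.inv_inv]

/-- A ray in a cusp whose image in `X` is infinite eventually runs straight into the cusp. -/
theorem exists_isCuspPath (hY : IsUniformTree Y) (hα : IsTreeLattice α)
    (hinv : WithoutInversions α)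
    {EF : Set (QEdge α)} (hEF : EF.Finite) {R : Set (Ray Y)} (hR : R.Finite)
    (hcov : ∀ e : QEdge α, e ∈ EF ∨ ∃ r ∈ R, ∃ n,
      e = projE α (r.edge n) ∨ e = projE α (r.edge n).symm)
    (r : Ray Y) (hc : IsCusp α r.toEnd)
    (hinf : (Set.range fun n => projE α (r.edge n)).Infinite) :
    ∃ M, IsCuspPath (fun n => projE α (r.edge (n + M))) ∧
      ∀ n, M ≤ n → (projE α (r.edge n)).inv.weight = valency Y (r.vertex (n + 1)) - 1 := by
  obtain ⟨N₁, hN₁⟩ := exists_forall_extends hY hα hEF hR hcov r hc hinf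
  obtain ⟨N₂, hN₂⟩ := hc.exists_transitive hY.isTree α r
  set N := max N₁ N₂ with hN
  set a : ℕ → QEdge α := fun n => projE α (r.edge n) with ha
  -- the edges that lead away from the cusp form one orbit under the stabilizer of their origin
  have htrans : ∀ n, N ≤ n → ∀ f : Y.Dart, f.fst = r.vertex (n + 1) → f.snd ≠ r.vertex (n + 2) →
      ∃ g : Γ, dartMap (α g) (r.edge n).symm = f := by
    intro n hn f hf hne
    obtain ⟨g, -, hg⟩ := hN₂ n (by omega) f hf hne (hN₁ (n + 1) (by omega) f hf)
      (hN₁ (n + 1) (by omega) _ rfl)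
    exact ⟨g, hg⟩
  have hnext : ∀ n, (a n).terminus = (a (n + 1)).origin := fun n => rfl
  have hsucc : ∀ n, N ≤ n → ∀ e : QEdge α, e.origin = (a n).terminus →
      e = a (n + 1) ∨ e = (a n).inv := by
    intro n hn e he
    obtain ⟨f, hf, rfl⟩ := QEdge.exists_lift (x := r.vertex (n + 1)) he
    by_cases h : f.snd = r.vertex (n + 2)
    · exact Or.inl (congrArg _ (dart_ext (f := r.edge (n + 1)) hf h))
    · exact Or.inr (projE_eq_iff.2 (htrans n hn f hf h)).symm
  obtain ⟨M, hNM, hM⟩ : ∃ M, N ≤ M ∧ ∀ n, M ≤ n → a (n + 1) ≠ (a n).inv := by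
    by_contra! hcon
    obtain ⟨n₁, h1, hf1⟩ := hcon N le_rfl
    obtain ⟨n₂, h2, hf2⟩ := hcon (n₁ + 1) (by omega)
    exact hinf (finite_range_of_folds hnext (by omega) (fun n hn => hsucc n (h1.trans hn)) hf1 hf2)
  -- an edge at an inner vertex that is equivalent to the ascending edge is equal to it
  have huniq : ∀ n, M ≤ n → ∀ f : Y.Dart, f.fst = r.vertex (n + 1) → projE α f = a (n + 1) →
      f.snd = r.vertex (n + 2) := by
    intro n hn f hf hfa
    by_contra hne
    refine hM n hn ?_
    rw [← hfa]
    exact (projE_eq_iff.2 (htrans n (hNM.trans hn) f hf hne)).symm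
  refine ⟨M, ⟨?_, ?_, fun n => ?_, fun n e he => ?_, fun n => ?_⟩, fun n hn => ?_⟩
  · -- a repetition would make the image periodic, hence finite
    have hlt : ∀ m k, M ≤ m → a m ≠ a (m + (k + 1)) := by
      intro m k hm h
      have hper : ∀ i, a (m + i) = a (m + i + (k + 1)) := by
        intro i
        induction i with
        | zero => exact h
        | succ i ih =>
          have ho : (a (m + i + 1)).origin = (a (m + i + (k + 1))).terminus := by
            rw [← ih]
            exact (hnext _).symm
          rcases hsucc _ (by omega) _ ho with h' | h'
          · change a (m + i + 1) = _
            rw [h']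
            congr 1
            ring
          · rw [← ih] at h'
            exact absurd h' (hM _ (by omega))
      refine hinf (((Set.finite_Iio (m + (k + 1))).image a).subset ?_)
      rintro _ ⟨n, rfl⟩
      induction n using Nat.strong_induction_on with
      | _ n ih =>
        rcases Nat.lt_or_ge n (m + (k + 1)) with hn | hn
        · exact ⟨n, hn, rfl⟩
        · have h2 := hper (n - (k + 1) - m)
          rw [show m + (n - (k + 1) - m) = n - (k + 1) by omega,
            show n - (k + 1) + (k + 1) = n by omega] at h2
          change a n ∈ _
          rw [← h2]
          exact ih _ (by omega)
    intro m n hmn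
    rcases Nat.lt_trichotomy m n with h | h | h
    · refine absurd hmn ?_
      obtain ⟨k, rfl⟩ := Nat.exists_eq_add_of_lt h
      convert hlt (m + M) k (by omega) using 3
      ring_nf
    · exact h
    · refine absurd hmn.symm ?_
      obtain ⟨k, rfl⟩ := Nat.exists_eq_add_of_lt h
      convert hlt (n + M) k (by omega) using 3
      ring_nf
  · refine ne_inv_of_no_fold (a := fun n => a (n + M)) (fun n => ?_) (fun n e he => ?_)
      (fun n => ?_) (fun n h => ?_)
    · rw [hnext, show n + 1 + M = n + M + 1 by ring]
    · rw [show n + 1 + M = n + M + 1 by ring]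
      exact hsucc _ (by omega) e he
    · rw [show n + 1 + M = n + M + 1 by ring]
      exact hM _ (by omega)
    · obtain ⟨g, hg⟩ := projE_eq_iff.1 h
      exact hinv g _ hg
  · change (a (n + M)).terminus = (a (n + 1 + M)).origin
    rw [hnext, show n + 1 + M = n + M + 1 by ring]
  · change e = a (n + 1 + M) ∨ _
    rw [show n + 1 + M = n + M + 1 by ring]
    exact hsucc _ (by omega) e he
  · change (originOrbit α (r.edge (n + 1 + M))).ncard = 1
    rw [show n + 1 + M = n + M + 1 by ring, Set.ncard_eq_one]
    refine ⟨r.edge (n + M + 1), Set.eq_singleton_iff_unique_mem.2 ⟨⟨1, ?_, ?_⟩, ?_⟩⟩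
    · rw [map_one]; rfl
    · rw [map_one]; rfl
    · rintro _ ⟨g, hg, rfl⟩
      exact dart_ext hg (huniq (n + M) (by omega) _ hg (projE_eq_iff.2 ⟨g, rfl⟩).symm)
  · have horb : originOrbit α (r.edge n).symm
        = {f : Y.Dart | f.fst = r.vertex (n + 1) ∧ f.snd ≠ r.vertex (n + 2)} := by
      ext f
      constructor
      · rintro ⟨g, hg, rfl⟩
        refine ⟨hg, fun h => hM n hn ?_⟩
        have h1 : dartMap (α g) (r.edge n).symm = r.edge (n + 1) := dart_ext hg h
        exact (projE_eq_iff.2 ⟨g, h1⟩).symm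
      · rintro ⟨hf, hne⟩
        obtain ⟨g, rfl⟩ := htrans n (hNM.trans hn) f hf hne
        exact ⟨g, hf, rfl⟩
    change (originOrbit α (r.edge n).symm).ncard = _
    have himg : (fun f : Y.Dart => f.snd) '' originOrbit α (r.edge n).symm
        = Y.neighborSet (r.vertex (n + 1)) \ {r.vertex (n + 2)} := by
      rw [horb]
      ext y
      constructor
      · rintro ⟨f, ⟨hf, hne⟩, rfl⟩
        exact ⟨by rw [SimpleGraph.mem_neighborSet, ← hf]; exact f.adj, hne⟩
      · rintro ⟨hy, hne⟩
        exact ⟨⟨(r.vertex (n + 1), y), hy⟩, ⟨rfl, hne⟩, rfl⟩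
    have hinj : Set.InjOn (fun f : Y.Dart => f.snd) (originOrbit α (r.edge n).symm) := by
      rw [horb]
      rintro f ⟨hf, -⟩ f' ⟨hf', -⟩ h
      exact dart_ext (hf.trans hf'.symm) h
    rw [← hinj.ncard_image, himg, Set.ncard_sdiff_singleton_of_mem]
    · rfl
    · exact r.adj (n + 1)

end Cusps

/-! ### Disjoint cusps -/

section DisjointCusps

variable {V : Type*} {Y : SimpleGraph V} {Γ : Type*} [Group Γ] {α : Γ →* (Y ≃g Y)}

namespace IsCuspPath

variable {a b : ℕ → QEdge α}

theorem shift (ha : IsCuspPath a) (M : ℕ) : IsCuspPath fun n => a (n + M) where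
  injective m n h := by have := ha.injective h; omega
  ne_inv m n := ha.ne_inv _ _
  next n := by rw [ha.next, show n + 1 + M = n + M + 1 by ring]
  eq_or_eq n e he := by
    rw [show n + 1 + M = n + M + 1 by ring]
    exact ha.eq_or_eq _ e he
  weight_succ n := by rw [show n + 1 + M = n + M + 1 by ring, ha.weight_succ]

/-- Two cusp paths with a common edge agree from there on. -/
theorem eq_add (ha : IsCuspPath a) (hb : IsCuspPath b) {m n : ℕ} (h : a m = b n) (k : ℕ) :
    a (m + k) = b (n + k) := by
  induction k with
  | zero => exact h
  | succ k ih =>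
    have ho : (a (m + k + 1)).origin = (b (n + k)).terminus := by rw [← ha.next, ih]
    rcases hb.eq_or_eq _ _ ho with h' | h'
    · exact h'
    · rw [← ih] at h'
      exact absurd h' (ha.ne_inv _ _)

/-- A cusp path that meets another one against its direction follows it back to its initial edge;
so this happens only in a bounded part of the path. -/
theorem eq_inv_zero (ha : IsCuspPath a) (hb : IsCuspPath b) {m n : ℕ} (h : a m = (b n).inv) :
    a (m + n) = (b 0).inv := by
  induction n generalizing m with
  | zero => exact h
  | succ n ih =>
    have ho : (a (m + 1)).origin = (b n).terminus := by
      rw [← ha.next, h, QEdge.terminus_inv, ← hb.next]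
    rcases hb.eq_or_eq _ _ ho with h' | h'
    · have : a (m + 1) = (a m).inv := by rw [h', h, QEdge.inv_inv]
      exact absurd this (ha.ne_inv _ _)
    · have := ih h'
      rwa [show m + 1 + n = m + (n + 1) by ring] at this

theorem exists_forall_ne_inv (ha : IsCuspPath a) (hb : IsCuspPath b) :
    ∃ M, ∀ m, M ≤ m → ∀ n, a m ≠ (b n).inv := by
  by_cases h : ∃ m n, a m = (b n).inv
  · obtain ⟨m₀, n₀, h₀⟩ := h
    refine ⟨m₀ + n₀ + 1, fun m hm n h => ?_⟩
    have := ha.injective ((ha.eq_inv_zero hb h).trans (ha.eq_inv_zero hb h₀).symm)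
    omega
  · push Not at h
    exact ⟨0, fun m _ n => h m n⟩

end IsCuspPath

/-- The weights of the descending edges of a cusp are periodic. -/
def HasPeriodicWeights (a : ℕ → QEdge α) : Prop :=
  ∃ k, 0 < k ∧ ∀ n, (a (n + k)).inv.weight = (a n).inv.weight

theorem HasPeriodicWeights.shift {a : ℕ → QEdge α} (ha : HasPeriodicWeights a) (M : ℕ) :
    HasPeriodicWeights fun n => a (n + M) := by
  obtain ⟨k, hk, h⟩ := ha
  exact ⟨k, hk, fun n => by simpa only [show n + k + M = n + M + k by ring] using h (n + M)⟩

/-- The edges of `X` outside a family of infinite paths and their inverses. -/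
def edgesOff (S : Set (ℕ → QEdge α)) : Set (QEdge α) :=
  {e | ∀ a ∈ S, ∀ n, e ≠ a n ∧ e ≠ (a n).inv}

/-- The edges of `X` that remain when the paths `A i` without their initial edges, and the inverses
of these edges, are removed. -/
def coreEdges {ι : Type*} (A : ι → ℕ → QEdge α) : Set (QEdge α) :=
  {e | ∀ i n, e ≠ A i (n + 1) ∧ e ≠ (A i (n + 1)).inv}

/-- A family of pairwise disjoint cusps of `X` with periodic weights, outside which there are only
finitely many edges. -/
structure IsCuspFamily {ι : Type*} (A : ι → ℕ → QEdge α) : Prop where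
  isCuspPath : ∀ i, IsCuspPath (A i)
  periodic : ∀ i, HasPeriodicWeights (A i)
  inj : ∀ {i i' m n}, A i m = A i' n → i = i' ∧ m = n
  ne_inv : ∀ i i' m n, A i m ≠ (A i' n).inv
  finite_core : (coreEdges A).Finite

/-- The quotient graph of a cuspidal lattice consists of finitely many edges and finitely many
pairwise disjoint cusps. -/
theorem exists_isCuspFamily (hY : IsUniformTree Y) (hα : IsTreeLattice α)
    (hinv : WithoutInversions α) (hcusp : IsCuspidal α) :
    ∃ (N : ℕ) (A : Fin N → ℕ → QEdge α), IsCuspFamily A := by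
  classical
  obtain ⟨-, EF, R, -, hEF, hR, -, hRc, -, hcov⟩ := hcusp
  have hray : ∀ r ∈ R, ∃ T : Finset (ℕ → QEdge α),
      (∀ a ∈ T, IsCuspPath a ∧ HasPeriodicWeights a) ∧
      {e | (∃ n, e = projE α (r.edge n) ∨ e = projE α (r.edge n).symm) ∧
        e ∈ edgesOff (T : Set (ℕ → QEdge α))}.Finite := by
    intro r hr
    by_cases hinf : (Set.range fun n => projE α (r.edge n)).Infinite
    · obtain ⟨M, hM, hw⟩ := exists_isCuspPath hY hα hinv hEF hR hcov r (hRc r hr).1 hinf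
      obtain ⟨N, k, hk, hper⟩ := (hRc r hr).2
      refine ⟨{fun n => projE α (r.edge (n + N + M))}, ?_, ?_⟩
      · intro a ha
        obtain rfl := Finset.mem_singleton.1 ha
        refine ⟨hM.shift N, k, hk, fun n => ?_⟩
        rw [hw _ (by omega), hw _ (by omega), hper (n + N + M + 1) (by omega)]
        congr 3
        ring
      · refine (((Set.finite_Iio (N + M)).image fun n => projE α (r.edge n)).union
          ((Set.finite_Iio (N + M)).image fun n => projE α (r.edge n).symm)).subset ?_
        rintro e ⟨⟨n, hn⟩, hoff⟩
        have hlt : n < N + M := by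
          by_contra hge
          have h := hoff _ (Finset.mem_coe.2 (Finset.mem_singleton_self _)) (n - (N + M))
          simp only [show n - (N + M) + N + M = n by omega] at h
          rcases hn with hn | hn
          · exact h.1 hn
          · exact h.2 hn
        rcases hn with hn | hn
        · exact Or.inl ⟨n, hlt, hn.symm⟩
        · exact Or.inr ⟨n, hlt, hn.symm⟩
    · rw [Set.not_infinite] at hinf
      refine ⟨∅, by simp, (hinf.union (hinf.image QEdge.inv)).subset ?_⟩
      rintro e ⟨⟨n, rfl | rfl⟩, -⟩
      · exact Or.inl ⟨n, rfl⟩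
      · exact Or.inr ⟨_, ⟨n, rfl⟩, rfl⟩
  choose! T hT hTfin using hray
  -- the members of a minimal family of cusp paths with finite complement are disjoint: of two paths
  -- that merge, one is superfluous
  let good : Finset (ℕ → QEdge α) → Prop := fun S =>
    (∀ a ∈ S, IsCuspPath a ∧ HasPeriodicWeights a) ∧
      (edgesOff (S : Set (ℕ → QEdge α))).Finite
  have hgood : good (hR.toFinset.biUnion T) := by
    refine ⟨fun a ha => ?_, (hEF.union (hR.biUnion hTfin)).subset fun e he => ?_⟩
    · obtain ⟨r, hr, ha⟩ := Finset.mem_biUnion.1 ha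
      exact hT r (hR.mem_toFinset.1 hr) a ha
    · rcases hcov e with h | ⟨r, hr, hn⟩
      · exact Or.inl h
      · exact Or.inr (Set.mem_biUnion hr ⟨hn, fun a ha => he a (Finset.mem_coe.2
          (Finset.mem_biUnion.2 ⟨r, hR.mem_toFinset.2 hr, ha⟩))⟩)
  obtain ⟨S, ⟨hS, hSfin⟩, hmin⟩ := exists_minimal_of_wellFoundedLT good ⟨_, hgood⟩
  have hdisj : ∀ a ∈ S, ∀ b ∈ S, a ≠ b → ∀ m n, a m ≠ b n := by
    intro a ha b hb hab m n h
    have h1 : good (S.erase a) := by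
      refine ⟨fun x hx => hS x (Finset.mem_of_mem_erase hx), (hSfin.union
        (((Set.finite_Iio m).image a).union
          ((Set.finite_Iio m).image fun i => (a i).inv))).subset fun e he => ?_⟩
      by_cases hoff : ∀ n, e ≠ a n ∧ e ≠ (a n).inv
      · left
        intro x hx
        by_cases hxa : x = a
        · rw [hxa]; exact hoff
        · exact he x (Finset.mem_coe.2 (Finset.mem_erase.2 ⟨hxa, hx⟩))
      · right
        push Not at hoff
        obtain ⟨i, hi⟩ := hoff
        have hbe := he b (Finset.mem_coe.2 (Finset.mem_erase.2 ⟨hab.symm, hb⟩))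
        have hlt : i < m := by
          by_contra hge
          have h2 := (hS a ha).1.eq_add (hS b hb).1 h (i - m)
          rw [show m + (i - m) = i by omega] at h2
          have h3 := hbe (n + (i - m))
          rw [← h2] at h3
          exact h3.2 (hi h3.1)
        by_cases hia : e = a i
        · exact Or.inl ⟨i, hlt, hia.symm⟩
        · exact Or.inr ⟨i, hlt, (hi hia).symm⟩
    exact Finset.notMem_erase a S (hmin h1 (Finset.erase_subset a S) ha)
  -- after shifting, no path meets another one against its direction
  have hM : ∃ M, ∀ a ∈ S, ∀ b ∈ S, ∀ m, M ≤ m → ∀ n, a m ≠ (b n).inv := by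
    have h : ∀ a ∈ S, ∀ b ∈ S, ∃ M, ∀ m, M ≤ m → ∀ n, a m ≠ (b n).inv := fun a ha b hb =>
      (hS a ha).1.exists_forall_ne_inv (hS b hb).1
    choose! M hM using h
    refine ⟨S.sup fun a => S.sup (M a), fun a ha b hb m hm => hM a ha b hb m (le_trans ?_ hm)⟩
    exact (Finset.le_sup hb).trans (Finset.le_sup (f := fun a => S.sup (M a)) ha)
  obtain ⟨M, hM⟩ := hM
  set f := S.equivFin.symm with hf
  refine ⟨S.card, fun i n => (f i).1 (n + M), ⟨fun i => (hS _ (f i).2).1.shift M,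
    fun i => (hS _ (f i).2).2.shift M, fun {i i' m n} h => ?_, fun i i' m n =>
      hM _ (f i).2 _ (f i').2 (m + M) (by omega) _, ?_⟩⟩
  · by_cases hii : i = i'
    · subst hii
      have := (hS _ (f i).2).1.injective h
      exact ⟨rfl, by omega⟩
    · exact absurd h (hdisj _ (f i).2 _ (f i').2
        (fun h => hii (f.injective (Subtype.ext h))) _ _)
  · refine (hSfin.union (S.finite_toSet.biUnion fun a _ => ((Set.finite_Iic M).image a).union
      ((Set.finite_Iic M).image fun i => (a i).inv))).subset fun e he => ?_
    by_cases hoff : e ∈ edgesOff (S : Set (ℕ → QEdge α))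
    · exact Or.inl hoff
    · right
      simp only [edgesOff, Set.mem_ofPred_eq, not_forall] at hoff
      obtain ⟨a, ha, n, hn⟩ := hoff
      have hle : n ≤ M := by
        by_contra hlt
        have := he (f.symm ⟨a, ha⟩) (n - (M + 1))
        simp only [Equiv.apply_symm_apply, show n - (M + 1) + 1 + M = n by omega] at this
        exact hn this
      refine Set.mem_biUnion ha ?_
      by_cases hna : e = a n
      · exact Or.inl ⟨n, hle, hna.symm⟩
      · refine Or.inr ⟨n, hle, ?_⟩
        by_contra hne
        exact hn ⟨hna, fun h => hne h.symm⟩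

end DisjointCusps

/-! ### The transition weights of the quotient graph -/

section Transitions

variable {V : Type*} {Y : SimpleGraph V} {Γ : Type*} [Group Γ] {α : Γ →* (Y ≃g Y)}

open Classical in
/-- The weight `w(e, e')` as a real number, extended by zero to the pairs of edges that are not
consecutive. -/
noncomputable def transWeight (e e' : QEdge α) : ℝ :=
  if e.terminus = e'.origin then (pairWeight e e' : ℝ) else 0

/-- The weight of a turn `e, e⁻¹` is nonnegative, because orbits of edges are nonempty and, the tree
being locally finite, finite. -/
theorem transWeight_nonneg (hY : ∀ x : V, (Y.neighborSet x).Finite) (e e' : QEdge α) :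
    0 ≤ transWeight e e' := by
  have hpos : 1 ≤ e'.weight := Quotient.inductionOn e' fun f => by
    have hfin : (originOrbit α f).Finite := by
      refine Set.Finite.of_finite_image (f := fun f : Y.Dart => f.snd) ((hY f.fst).subset ?_) ?_
      · rintro _ ⟨_, ⟨g, hg, rfl⟩, rfl⟩
        have := (dartMap (α g) f).adj
        rwa [dartMap_fst, hg] at this
      · rintro _ ⟨g, hg, rfl⟩ _ ⟨g', hg', rfl⟩ h
        exact dart_ext (hg.trans hg'.symm) h
    exact (Set.ncard_pos hfin).2 ⟨f, 1, by rw [map_one]; rfl, by rw [map_one]; rfl⟩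
  have hpos' : (1 : ℤ) ≤ e'.weight := by exact_mod_cast hpos
  unfold transWeight pairWeight
  split_ifs <;> norm_cast <;> omega

theorem chainWeight_transWeight (a b : QEdge α) (l : List (QEdge α))
    (h : List.IsChain (fun e e' : QEdge α => e.terminus = e'.origin) (a :: (l ++ [b]))) :
    chainWeight transWeight a l b = ((chainWeight pairWeight a l b : ℤ) : ℝ) := by
  induction l generalizing a with
  | nil => simp only [List.nil_append, List.isChain_pair] at h; simp [chainWeight, transWeight, h]
  | cons x l ih =>
    rw [List.cons_append, List.isChain_cons_cons] at h
    rw [chainWeight, chainWeight, ih x h.2, transWeight, if_pos h.1, Int.cast_mul]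

theorem PrimeCycle.weight_eq (c : PrimeCycle α) :
    (c.weight : ℝ) = closedWeight transWeight c.word := by
  have h1 : c.weight = closedWeight pairWeight c.word := by
    rw [PrimeCycle.weight, ← c.coe_word]; rfl
  have h2 : Cycle.Chain (fun e e' : QEdge α => e.terminus = e'.origin)
      (c.word : Cycle (QEdge α)) := by
    rw [c.coe_word]; exact c.2.1.2
  rw [h1]
  rcases hw : c.word with _ | ⟨a, l⟩
  · simp [closedWeight]
  · rw [hw, Cycle.chain_coe_cons] at h2
    rw [closedWeight_cons, closedWeight_cons, chainWeight_transWeight _ _ _ h2]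

theorem QEdge.inv_eq_iff {e f : QEdge α} : e.inv = f ↔ e = f.inv :=
  ⟨fun h => by rw [← h, QEdge.inv_inv], fun h => by rw [h, QEdge.inv_inv]⟩

namespace IsCuspPath

variable {a : ℕ → QEdge α}

open Classical in
/-- An ascending path in a cusp either continues to ascend or turns back. -/
theorem transWeight_left (ha : IsCuspPath a) (n : ℕ) (e : QEdge α) :
    transWeight (a n) e =
      if e = a (n + 1) then 1 else if e = (a n).inv then ((a n).inv.weight : ℝ) - 1 else 0 := by
  by_cases h1 : e = a (n + 1)
  · subst h1
    rw [if_pos rfl, transWeight, if_pos (ha.next n), pairWeight, if_neg (ha.ne_inv _ _),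
      ha.weight_succ]
    norm_num
  · rw [if_neg h1]
    by_cases h2 : e = (a n).inv
    · subst h2
      rw [if_pos rfl, transWeight, if_pos (QEdge.origin_inv _).symm, pairWeight, if_pos rfl]
      push_cast
      rfl
    · rw [if_neg h2, transWeight, if_neg]
      intro h
      rcases ha.eq_or_eq n e h.symm with h | h
      · exact h1 h
      · exact h2 h

open Classical in
/-- A descending path in a cusp continues to descend: turning back would mean to continue with the
only edge leading into the cusp, and the weight of that turn is `1 - 1`. -/
theorem transWeight_inv_left (ha : IsCuspPath a) (n : ℕ) (e : QEdge α) :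
    transWeight (a (n + 1)).inv e = if e = (a n).inv then ((a n).inv.weight : ℝ) else 0 := by
  by_cases h1 : e = (a n).inv
  · subst h1
    rw [if_pos rfl, transWeight, if_pos, pairWeight, if_neg]
    · push_cast
      rfl
    · rw [QEdge.inv_inv]
      exact fun h => ha.ne_inv _ _ h.symm
    · rw [QEdge.terminus_inv, QEdge.origin_inv, ha.next]
  · rw [if_neg h1, transWeight]
    split_ifs with h
    · rw [QEdge.terminus_inv, ← ha.next] at h
      obtain rfl := (ha.eq_or_eq n e h.symm).resolve_right h1
      rw [pairWeight, if_pos (QEdge.inv_inv _).symm, ha.weight_succ]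
      norm_num
    · rfl

open Classical in
/-- An ascending edge of positive height is reached only from the ascending edge below it, since
turning upwards from a descending edge has weight zero. -/
theorem transWeight_right (ha : IsCuspPath a) (n : ℕ) (e : QEdge α) :
    transWeight e (a (n + 1)) = if e = a n then 1 else 0 := by
  by_cases h1 : e = a n
  · rw [h1, if_pos rfl, ha.transWeight_left, if_pos rfl]
  · rw [if_neg h1]
    by_cases h : e.terminus = (a (n + 1)).origin
    · have h2 : e.inv.origin = (a n).terminus := by rw [QEdge.origin_inv, h, ha.next]
      rcases ha.eq_or_eq n _ h2 with h3 | h3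
      · rw [QEdge.inv_eq_iff.1 h3, ha.transWeight_inv_left, if_neg (ha.ne_inv _ _)]
      · rw [QEdge.inv_eq_iff, QEdge.inv_inv] at h3
        exact absurd h3 h1
    · rw [transWeight, if_neg h]

/-- A descending edge is reached only from its inverse and from the descending edge above it. -/
theorem transWeight_inv_right (ha : IsCuspPath a) (n : ℕ) {e : QEdge α} (h1 : e ≠ a (n + 1))
    (h2 : e ≠ (a (n + 2)).inv) : transWeight e (a (n + 1)).inv = 0 := by
  rw [transWeight, if_neg]
  intro h
  rw [QEdge.origin_inv, ← QEdge.origin_inv e] at h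
  rcases ha.eq_or_eq (n + 1) _ h with h3 | h3
  · exact h2 (QEdge.inv_eq_iff.1 h3)
  · rw [QEdge.inv_eq_iff, QEdge.inv_inv] at h3
    exact h1 h3

end IsCuspPath

end Transitions

/-! ### Truncations of the quotient graph -/

section Truncation

open Filter Topology

variable {V : Type*} {Y : SimpleGraph V} {Γ : Type*} [Group Γ] {α : Γ →* (Y ≃g Y)}
  {ι : Type*} {A : ι → ℕ → QEdge α}

/-- The edges of `X` up to height `K` in the cusps: the core, the ascending edges and the descending
edges. -/
def truncation (A : ι → ℕ → QEdge α) (K : ℕ) :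
    coreEdges A ⊕ (ι × Fin K ⊕ ι × Fin K) → QEdge α :=
  Sum.elim Subtype.val (Sum.elim (fun x => A x.1 (x.2 + 1)) fun x => (A x.1 (x.2 + 1)).inv)

theorem QEdge.inv_inj {e f : QEdge α} (h : e.inv = f.inv) : e = f := by
  rwa [QEdge.inv_eq_iff, QEdge.inv_inv] at h

theorem exists_of_notMem_coreEdges {e : QEdge α} (he : e ∉ coreEdges A) :
    ∃ i n, e = A i (n + 1) ∨ e = (A i (n + 1)).inv := by
  by_contra! h
  exact he h

namespace IsCuspFamily

theorem zero_mem_core (h : IsCuspFamily A) (i : ι) : A i 0 ∈ coreEdges A := fun i' n =>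
  ⟨fun h0 => by have := (h.inj h0).2; omega, h.ne_inv _ _ _ _⟩

theorem zero_inv_mem_core (h : IsCuspFamily A) (i : ι) : (A i 0).inv ∈ coreEdges A := fun i' n =>
  ⟨fun h0 => h.ne_inv _ _ _ _ h0.symm,
    fun h0 => by have := (h.inj (QEdge.inv_inj h0)).2; omega⟩

theorem eq_zero_of_mem_core {i : ι} {n : ℕ} (h0 : A i n ∈ coreEdges A) : n = 0 := by
  rcases n with _ | n
  · rfl
  · exact absurd rfl (h0 i n).1

theorem eq_zero_of_inv_mem_core {i : ι} {n : ℕ} (h0 : (A i n).inv ∈ coreEdges A) : n = 0 := by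
  rcases n with _ | n
  · rfl
  · exact absurd rfl (h0 i n).2

theorem truncation_injective (h : IsCuspFamily A) (K : ℕ) :
    Function.Injective (truncation A K) := by
  rintro (⟨f, hf⟩ | ⟨i, n⟩ | ⟨i, n⟩) (⟨f', hf'⟩ | ⟨i', n'⟩ | ⟨i', n'⟩) h0
  · exact congrArg Sum.inl (Subtype.ext h0)
  · exact absurd h0 (hf _ _).1
  · exact absurd h0 (hf _ _).2
  · exact absurd h0.symm (hf' _ _).1
  · obtain ⟨rfl, h1⟩ := h.inj h0
    obtain rfl : n = n' := Fin.ext (by simpa using h1)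
    rfl
  · exact absurd h0 (h.ne_inv _ _ _ _)
  · exact absurd h0.symm (hf' _ _).2
  · exact absurd h0.symm (h.ne_inv _ _ _ _)
  · obtain ⟨rfl, h1⟩ := h.inj (QEdge.inv_inj h0)
    obtain rfl : n = n' := Fin.ext (by simpa using h1)
    rfl

theorem eventually_mem_range_truncation (e : QEdge α) :
    ∀ᶠ K in atTop, e ∈ Set.range (truncation A K) := by
  by_cases he : e ∈ coreEdges A
  · exact Eventually.of_forall fun K => ⟨.inl ⟨e, he⟩, rfl⟩
  · obtain ⟨i, n, hn⟩ := exists_of_notMem_coreEdges he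
    filter_upwards [eventually_gt_atTop n] with K hK
    rcases hn with rfl | rfl
    · exact ⟨.inr (.inl (i, ⟨n, hK⟩)), rfl⟩
    · exact ⟨.inr (.inr (i, ⟨n, hK⟩)), rfl⟩

theorem exists_weight_bound [Fintype ι] (h : IsCuspFamily A) :
    ∃ Ω : ℝ, 0 ≤ Ω ∧ ∀ i n, ((A i n).inv.weight : ℝ) ≤ Ω := by
  have hb : ∀ i, ∃ B : ℝ, ∀ n, ((A i n).inv.weight : ℝ) ≤ B := by
    intro i
    obtain ⟨k, hk, hp⟩ := h.periodic i
    obtain ⟨B, hB⟩ := exists_bound_of_periodic (c := fun n => ((A i n).inv.weight : ℂ)) hk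
      fun n => by rw [hp]
    exact ⟨B, fun n => by simpa using hB n⟩
  choose B hB using hb
  refine ⟨∑ i, |B i|, Finset.sum_nonneg fun i _ => abs_nonneg _,
    fun i n => (hB i n).trans ((le_abs_self _).trans ?_)⟩
  exact Finset.single_le_sum (f := fun i => |B i|) (fun _ _ => abs_nonneg _) (Finset.mem_univ i)

/-- From the core one can only stay in the core or enter a cusp through its lowest edge. -/
theorem transWeight_core (h : IsCuspFamily A) {e e' : QEdge α} (he : e ∈ coreEdges A)
    (hne : transWeight e e' ≠ 0) : e' ∈ coreEdges A ∨ ∃ i, e' = A i 1 := by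
  classical
  by_contra! hcon
  obtain ⟨i, n, rfl | rfl⟩ := exists_of_notMem_coreEdges hcon.1
  · rw [(h.isCuspPath i).transWeight_right] at hne
    have h2 : e = A i n := by
      by_contra h3
      exact hne (if_neg h3)
    obtain rfl := eq_zero_of_mem_core (h2 ▸ he)
    exact hcon.2 i rfl
  · exact hne ((h.isCuspPath i).transWeight_inv_right n (he i n).1 (he i (n + 1)).2)

/-- The total weights of the transitions from the edges of `X` are bounded. -/
theorem exists_transWeight_sum_bound [Fintype ι] (h : IsCuspFamily A)
    (hnn : ∀ e e' : QEdge α, 0 ≤ transWeight e e') :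
    ∃ B : ℝ, 0 < B ∧ ∀ e : QEdge α, ∀ s : Finset (QEdge α), ∑ e' ∈ s, transWeight e e' ≤ B := by
  classical
  have := h.finite_core.fintype
  obtain ⟨Ω, hΩ0, hΩ⟩ := exists_weight_bound h
  have hle : ∀ (e : QEdge α) (T s : Finset (QEdge α)), (∀ e', transWeight e e' ≠ 0 → e' ∈ T) →
      ∑ e' ∈ s, transWeight e e' ≤ ∑ e' ∈ T, transWeight e e' := by
    intro e T s hT
    rw [← Finset.sum_filter_ne_zero]
    exact Finset.sum_le_sum_of_subset_of_nonneg
      (fun e' he' => hT e' (Finset.mem_filter.1 he').2) fun _ _ _ => hnn _ _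
  set T : Finset (QEdge α) := (coreEdges A).toFinset ∪ Finset.univ.image fun i => A i 1 with hT
  have hpos : 0 ≤ ∑ e ∈ (coreEdges A).toFinset, ∑ e' ∈ T, transWeight e e' :=
    Finset.sum_nonneg fun e _ => Finset.sum_nonneg fun e' _ => hnn e e'
  refine ⟨(∑ e ∈ (coreEdges A).toFinset, ∑ e' ∈ T, transWeight e e') + (1 + Ω), by linarith,
    fun e s => ?_⟩
  by_cases he : e ∈ coreEdges A
  · have h1 : ∑ e' ∈ s, transWeight e e' ≤ ∑ e' ∈ T, transWeight e e' := by
      refine hle e T s fun e' hne => ?_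
      rcases transWeight_core h he hne with h2 | ⟨i, rfl⟩
      · exact Finset.mem_union_left _ (Set.mem_toFinset.2 h2)
      · exact Finset.mem_union_right _ (Finset.mem_image_of_mem _ (Finset.mem_univ i))
    have h2 : ∑ e' ∈ T, transWeight e e'
        ≤ ∑ e ∈ (coreEdges A).toFinset, ∑ e' ∈ T, transWeight e e' :=
      Finset.single_le_sum (f := fun e => ∑ e' ∈ T, transWeight e e')
        (fun e _ => Finset.sum_nonneg fun e' _ => hnn e e') (Set.mem_toFinset.2 he)
    linarith
  · obtain ⟨i, n, rfl | rfl⟩ := exists_of_notMem_coreEdges he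
    · refine (hle _ {A i (n + 1 + 1), (A i (n + 1)).inv} s fun e' h0 => ?_).trans ?_
      · rw [(h.isCuspPath i).transWeight_left] at h0
        rw [Finset.mem_insert, Finset.mem_singleton]
        by_contra h2
        rw [not_or] at h2
        rw [if_neg h2.1, if_neg h2.2] at h0
        exact h0 rfl
      · rw [Finset.sum_pair (h.ne_inv _ _ _ _), (h.isCuspPath i).transWeight_left, if_pos rfl,
          (h.isCuspPath i).transWeight_left, if_neg (fun h0 => h.ne_inv _ _ _ _ h0.symm),
          if_pos rfl]
        linarith [hΩ i (n + 1)]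
    · refine (hle _ {(A i n).inv} s fun e' h0 => ?_).trans ?_
      · rw [(h.isCuspPath i).transWeight_inv_left] at h0
        rw [Finset.mem_singleton]
        by_contra h2
        exact h0 (if_neg h2)
      · rw [Finset.sum_singleton, (h.isCuspPath i).transWeight_inv_left, if_pos rfl]
        linarith [hΩ i n]

open Classical in
/-- The matrix of the transitions of the truncated graph, in block form. -/
theorem truncation_matrix [Fintype ι] [Fintype (coreEdges A)] (h : IsCuspFamily A) (K : ℕ) :
    (Matrix.of fun x y => ((transWeight (truncation A K x) (truncation A K y) : ℝ) : ℂ))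
      = Matrix.fromBlocks
        (Matrix.of fun f f' : coreEdges A => ((transWeight f.1 f'.1 : ℝ) : ℂ))
        (enterBlock K fun i => ⟨A i 0, h.zero_mem_core i⟩)
        (leaveBlock K (fun i => ⟨(A i 0).inv, h.zero_inv_mem_core i⟩)
          fun i n => ((A i n).inv.weight : ℂ))
        (cuspBlock K (fun i n => ((A i n).inv.weight : ℂ))
          fun i n => ((A i (n + 1)).inv.weight : ℂ) - 1) := by
  ext (⟨f, hf⟩ | ⟨i, n⟩ | ⟨i, n⟩) (⟨f', hf'⟩ | ⟨i', n'⟩ | ⟨i', n'⟩)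
  · rfl
  · change ((transWeight f (A i' (n' + 1)) : ℝ) : ℂ)
      = if (⟨f, hf⟩ : coreEdges A) = ⟨A i' 0, h.zero_mem_core i'⟩ ∧ (n' : ℕ) = 0 then 1 else 0
    have h1 : f = A i' n' ↔
        ((⟨f, hf⟩ : coreEdges A) = ⟨A i' 0, h.zero_mem_core i'⟩ ∧ (n' : ℕ) = 0) := by
      rw [Subtype.mk.injEq]
      refine ⟨fun h2 => ?_, fun ⟨h2, h3⟩ => by rw [h3, h2]⟩
      have h0 : (n' : ℕ) = 0 := eq_zero_of_mem_core (h2 ▸ hf)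
      exact ⟨by rw [h2, h0], h0⟩
    simp only [(h.isCuspPath i').transWeight_right, h1]
    split_ifs <;> simp
  · change ((transWeight f (A i' (n' + 1)).inv : ℝ) : ℂ) = 0
    rw [(h.isCuspPath i').transWeight_inv_right n' (hf i' n').1 (hf i' (n' + 1)).2,
      Complex.ofReal_zero]
  · change ((transWeight (A i (n + 1)) f' : ℝ) : ℂ) = 0
    rw [(h.isCuspPath i).transWeight_left, if_neg (hf' i (n + 1)).1, if_neg (hf' i n).2,
      Complex.ofReal_zero]
  · change ((transWeight (A i (n + 1)) (A i' (n' + 1)) : ℝ) : ℂ)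
      = if i' = i ∧ (n' : ℕ) = n + 1 then 1 else 0
    have h1 : A i' (n' + 1) = A i (n + 1 + 1) ↔ (i' = i ∧ (n' : ℕ) = n + 1) := by
      refine ⟨fun h2 => ?_, fun ⟨h2, h3⟩ => by rw [h2, h3]⟩
      have h3 := h.inj h2
      exact ⟨h3.1, by simpa using h3.2⟩
    simp only [(h.isCuspPath i).transWeight_left, h1, h.ne_inv, if_false]
    split_ifs <;> simp
  · change ((transWeight (A i (n + 1)) (A i' (n' + 1)).inv : ℝ) : ℂ)
      = if (i', n') = (i, n) then ((A i (n + 1)).inv.weight : ℂ) - 1 else 0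
    rw [(h.isCuspPath i).transWeight_left, if_neg fun h0 => h.ne_inv _ _ _ _ h0.symm]
    have h1 : (A i' (n' + 1)).inv = (A i (n + 1)).inv ↔ (i', n') = (i, n) := by
      refine ⟨fun h2 => ?_, fun h2 => ?_⟩
      · have h3 := h.inj (QEdge.inv_inj h2)
        exact Prod.ext h3.1 (Fin.ext (by simpa using h3.2))
      · obtain ⟨rfl, rfl⟩ := Prod.mk.inj h2
        rfl
    simp only [h1]
    split_ifs <;> simp
  · change ((transWeight (A i (n + 1)).inv f' : ℝ) : ℂ)
      = if (⟨f', hf'⟩ : coreEdges A) = ⟨(A i 0).inv, h.zero_inv_mem_core i⟩ ∧ (n : ℕ) = 0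
        then ((A i n).inv.weight : ℂ) else 0
    have h1 : f' = (A i n).inv ↔
        ((⟨f', hf'⟩ : coreEdges A) = ⟨(A i 0).inv, h.zero_inv_mem_core i⟩ ∧ (n : ℕ) = 0) := by
      rw [Subtype.mk.injEq]
      refine ⟨fun h2 => ?_, fun ⟨h2, h3⟩ => by rw [h3, h2]⟩
      have h0 : (n : ℕ) = 0 := eq_zero_of_inv_mem_core (h2 ▸ hf')
      exact ⟨by rw [h2, h0], h0⟩
    simp only [(h.isCuspPath i).transWeight_inv_left, h1]
    split_ifs <;> simp
  · change ((transWeight (A i (n + 1)).inv (A i' (n' + 1)) : ℝ) : ℂ) = 0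
    rw [(h.isCuspPath i).transWeight_inv_left, if_neg (h.ne_inv _ _ _ _), Complex.ofReal_zero]
  · change ((transWeight (A i (n + 1)).inv (A i' (n' + 1)).inv : ℝ) : ℂ)
      = if i' = i ∧ (n : ℕ) = n' + 1 then ((A i n).inv.weight : ℂ) else 0
    have h1 : (A i' (n' + 1)).inv = (A i n).inv ↔ (i' = i ∧ (n : ℕ) = n' + 1) := by
      refine ⟨fun h2 => ?_, fun ⟨h2, h3⟩ => by rw [h2, h3]⟩
      have h3 := h.inj (QEdge.inv_inj h2)
      exact ⟨h3.1, h3.2.symm⟩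
    simp only [(h.isCuspPath i).transWeight_inv_left, h1]
    split_ifs <;> simp

end IsCuspFamily

end Truncation

/-! ### Rationality -/

section Main

open Filter Topology

/-- The determinants of the truncations at height `K` converge near the origin, as `K` tends to
infinity, to a rational function: the height enters only through the generating functions of the
excursions. -/
theorem exists_rational_limit {F ι : Type*} [Fintype F] [DecidableEq F] [Fintype ι] [DecidableEq ι]
    (A : Matrix F F ℂ) (a b : ι → F) (c d : ι → ℕ → ℂ)
    (hper : ∀ i, ∃ k, 0 < k ∧ (∀ n, c i (n + k) = c i n) ∧ ∀ n, d i (n + k) = d i n) :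
    ∃ P : ℂ → ℂ, IsRationalNearZero P ∧ P 0 = 1 ∧ ∀ᶠ u in 𝓝 (0 : ℂ),
      Tendsto (fun K => (1 - u • Matrix.fromBlocks A (enterBlock K a) (leaveBlock K b c)
        (cuspBlock K c d)).det) atTop (𝓝 (P u)) := by
  have h : ∀ i, ∃ G : ℂ → ℂ, IsRationalNearZero G ∧ ∃ ε : ℝ, 0 < ε ∧ ∀ u : ℂ, ‖u‖ < ε →
      Tendsto (fun K => excursion (c i) (d i) K u) atTop (𝓝 (G u)) := by
    intro i
    obtain ⟨k, hk, hc, hd⟩ := hper i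
    exact exists_tendsto_excursion hk hc hd
  choose G hG ε hε hlim using h
  refine ⟨fun u => (1 - u • A - Matrix.of fun f f' => ∑ i, if f = a i ∧ f' = b i
    then u * G i u else 0).det, IsRationalNearZero.det fun f f' => ?_, ?_, ?_⟩
  · have h1 : (fun u : ℂ => (1 - u • A - Matrix.of fun f f' => ∑ i, if f = a i ∧ f' = b i
        then u * G i u else 0) f f') = fun u : ℂ => (1 : Matrix F F ℂ) f f' + (-A f f') * u
          + ∑ i, (if f = a i ∧ f' = b i then (-1 : ℂ) else 0) * (u * G i u) := by
      funext u
      simp only [Matrix.sub_apply, Matrix.of_apply, ite_mul,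
        zero_mul, sub_eq_add_neg, ← Finset.sum_neg_distrib]
      congr 1
      · rw [Matrix.add_apply, Matrix.neg_apply, Matrix.smul_apply, smul_eq_mul]
        ring
      · exact Finset.sum_congr rfl fun i _ => by split_ifs <;> ring
    rw [h1]
    exact ((IsRationalNearZero.const _).add ((IsRationalNearZero.const _).mul .id)).add
      (IsRationalNearZero.sum _ fun i => (IsRationalNearZero.const _).mul
        (IsRationalNearZero.id.mul (hG i)))
  · have h0 : (Matrix.of fun f f' => ∑ i, if f = a i ∧ f' = b i then (0 : ℂ) * G i 0 else 0)
        = (0 : Matrix F F ℂ) := by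
      ext f f'
      simp
    simp only [h0, zero_smul, sub_zero, Matrix.det_one]
  · have hev : ∀ᶠ u in 𝓝 (0 : ℂ), ∀ i, ‖u‖ < ε i := by
      rw [eventually_all]
      intro i
      filter_upwards [Metric.ball_mem_nhds (0 : ℂ) (hε i)] with u hu
      simpa using hu
    filter_upwards [hev] with u hu
    simp only [det_cusp_elimination]
    refine ((Continuous.matrix_det continuous_id).tendsto _).comp (tendsto_pi_nhds.2 fun f =>
      tendsto_pi_nhds.2 fun f' => ?_)
    refine Tendsto.sub tendsto_const_nhds (tendsto_finsetSum _ fun i _ => ?_)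
    split_ifs
    · exact (hlim i u (hu i)).const_mul u
    · exact tendsto_const_nhds

end Main

end TreeLattice

open Filter Topology in
theorem theorem2p2 {V : Type*} (Y : SimpleGraph V) (hY : TreeLattice.IsUniformTree Y)
    {Γ : Type*} [Group Γ] (α : Γ →* (Y ≃g Y))
    (hα : TreeLattice.IsTreeLattice α) (hinv : TreeLattice.WithoutInversions α)
    (hcusp : TreeLattice.IsCuspidal α) :
    ∃ ε : ℝ, 0 < ε ∧ ∃ p q : Polynomial ℂ, ∀ u : ℂ, ‖u‖ < ε →
      (∀ c : TreeLattice.PrimeCycle α, 1 - (c.weight : ℂ) * u ^ c.length ≠ 0) ∧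
      p.eval u ≠ 0 ∧ q.eval u ≠ 0 ∧
      HasProd (fun c : TreeLattice.PrimeCycle α => (1 - (c.weight : ℂ) * u ^ c.length)⁻¹)
        (p.eval u / q.eval u) := by
  classical
  obtain ⟨N, A, hA⟩ := TreeLattice.exists_isCuspFamily hY hα hinv hcusp
  have := hA.finite_core.fintype
  have hnn := TreeLattice.transWeight_nonneg (α := α) hY.locallyFinite
  obtain ⟨B, hB, hrow⟩ := hA.exists_transWeight_sum_bound hnn
  obtain ⟨P, ⟨p, q, hq, hPq⟩, hP1, hPlim⟩ := TreeLattice.exists_rational_limit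
    (Matrix.of fun f f' : TreeLattice.coreEdges A =>
      ((TreeLattice.transWeight f.1 f'.1 : ℝ) : ℂ))
    (fun i => ⟨A i 0, hA.zero_mem_core i⟩) (fun i => ⟨(A i 0).inv, hA.zero_inv_mem_core i⟩)
    (fun i n => ((A i n).inv.weight : ℂ)) (fun i n => ((A i (n + 1)).inv.weight : ℂ) - 1)
    fun i => by
      obtain ⟨k, hk, hper⟩ := hA.periodic i
      refine ⟨k, hk, fun n => by rw [hper], fun n => ?_⟩
      rw [show n + k + 1 = n + 1 + k by ring, hper]
  have hp0 : p.eval 0 ≠ 0 := by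
    have := hPq.self_of_nhds
    rw [hP1, one_mul] at this
    rwa [← this]
  have hev : ∀ᶠ u in 𝓝 (0 : ℂ), p.eval u ≠ 0 ∧ q.eval u ≠ 0 ∧ P u * q.eval u = p.eval u ∧
      ‖u‖ * B ≤ 1 / 2 ∧ Tendsto (fun K => (1 - u • (Matrix.of fun x y =>
        ((TreeLattice.transWeight (TreeLattice.truncation A K x)
          (TreeLattice.truncation A K y) : ℝ) : ℂ))).det) atTop (𝓝 (P u)) := by
    have h1 : ∀ᶠ u in 𝓝 (0 : ℂ), p.eval u ≠ 0 := p.continuous.continuousAt.eventually_ne hp0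
    have h2 : ∀ᶠ u in 𝓝 (0 : ℂ), q.eval u ≠ 0 := q.continuous.continuousAt.eventually_ne hq
    have h3 : ∀ᶠ u in 𝓝 (0 : ℂ), ‖u‖ * B ≤ 1 / 2 := by
      filter_upwards [Metric.ball_mem_nhds (0 : ℂ) (show 0 < 1 / (2 * B) by positivity)] with u hu
      rw [mem_ball_zero_iff, lt_div_iff₀ (by positivity)] at hu
      linarith
    filter_upwards [h1, h2, hPq, h3, hPlim] with u h1 h2 h3 h4 h5
    refine ⟨h1, h2, h3, h4, h5.congr fun K => ?_⟩
    rw [hA.truncation_matrix]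
    congr!
  obtain ⟨ε, hε, hball⟩ := Metric.eventually_nhds_iff.1 hev
  have hball' := fun (u : ℂ) (hu : ‖u‖ < ε) => hball (show dist u 0 < ε by simpa using hu)
  -- the limit `P = p / q` of the determinants is the reciprocal of the Euler product
  refine ⟨ε, hε, q, p, fun u hu => ?_⟩
  obtain ⟨h1, h2, h3, h4, h5⟩ := hball' u hu
  have hcast : ∀ c : TreeLattice.PrimeCycle α, (c.weight : ℂ)
      = ((TreeLattice.closedWeight TreeLattice.transWeight c.word : ℝ) : ℂ) := fun c => by
    rw [← c.weight_eq]
    norm_cast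
  obtain ⟨hfac, hprod⟩ := TreeLattice.hasProd_of_tendsto_det (α := α) TreeLattice.transWeight hnn
    (fun e e' h => by
      by_contra h0
      exact h (if_neg h0))
    (TreeLattice.truncation A) hA.truncation_injective
    TreeLattice.IsCuspFamily.eventually_mem_range_truncation hB
    (fun K x => by
      rw [← Finset.sum_image (f := fun e' =>
        TreeLattice.transWeight (TreeLattice.truncation A K x) e')
          (hA.truncation_injective K).injOn]
      exact hrow _ _)
    (fun v hv => (hball' v hv).2.2.2.2)
    (fun v hv h0 => (hball' v hv).1 (by rw [← (hball' v hv).2.2.1, h0, zero_mul])) hu h4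
  refine ⟨fun c h0 => ?_, h2, h1, ?_⟩
  · have := hfac c
    rw [← hcast, ← sub_eq_zero.1 h0, norm_one] at this
    norm_num at this
  · have hPu : q.eval u / p.eval u = (P u)⁻¹ := by
      rw [← h3] at h1 ⊢
      have := left_ne_zero_of_mul h1
      field_simp
    rw [hPu]
    simpa only [hcast] using hprod
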